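/- Let $G=(V,E,\Theta)$ be a weighted graph with $V=\{1,\dots,n\}$, $n\ge 1$, and real weights $\theta_{jk}=\theta_{kj}$ ($\theta_{jk}=0$ if $(j,k)\notin E$), and let $$|G\rangle=\Big[\prod_{(j,k)\in E,\ j<k}\Lambda_{jk}(\theta_{jk})\Big]|+\rangle^{\otimes n},\qquad \Lambda_{jk}(\theta)=|0\rangle\langle 0|_j\otimes I_k+|1\rangle\langle 1|_j\otimes(|0\rangle\langle 0|_k+e^{i\theta}|1\rangle\langle 1|_k)$$ be its weighted graph state. Let $\mathscr A=\{A_1,\dots,A_m\}$ be pairwise disjoint independent sets of $G$ with $\bigcup_l A_l=V$, and let $h\ge 1$ and $N\ge 1$ be integers. Write $|\alpha\rangle=\frac1{\sqrt2}(|0\rangle+e^{i\alpha}|1\rangle)$. For $k\in A_l$ and $\mathbf z\in\{0,1\}^{A_l^c}$ put $\alpha_k(\mathbf z)=\sum_{j:(j,k)\in E}\theta_{jk}z_j$, and let $\alpha_k^h(\mathbf z)$ be the number $\frac{r\pi}{h}$, $r\in\mathbb Z$, with $\frac{r\pi}{h}-\frac{\pi}{2h}\le\alpha_k(\mathbf z)<\frac{r\pi}{h}+\frac{\pi}{2h}$.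 Define $$Q_{k;h}=\sum_{\mathbf z}|\alpha_k^h(\mathbf z)\rangle\langle\alpha_k^h(\mathbf z)|_k\otimes|\mathbf z\rangle\langle\mathbf z|_{A_l^c},\qquad \bar P_{l;h}=\prod_{k\in A_l}\Big(\tfrac1h Q_{k;h}+\tfrac{h-1}{h}I\Big),\qquad \bar\Omega_h(\mathscr A)=\frac1m\sum_{l=1}^m\bar P_{l;h},$$ where $Q_{k;h}$ acts as the identity on the qubits of $A_l\setminus\{k\}$. In the $N$-random sampling test of $\bar\Omega_h(\mathscr A)$ on $N+1$ (possibly correlated or entangled) $n$-qubit systems, $N$ of the systems are chosen uniformly at random, each of them is measured with the POVM $\{\bar\Omega_h(\mathscr A),I-\bar\Omega_h(\mathscr A)\}$, and the test is passed if all the outcomes correspond to $\bar\Omega_h(\mathscr A)$; the resultant state $\sigma$ is then the state of the remaining system conditioned on passing (averaged over the random choice). Assume $\beta\ge\frac1{N+1}$. Then: 1. The state $|G\rangle^{\otimes(N+1)}$ passes the test with probability at least $\left(1-\frac1h\sin^2\frac{\pi}{4h}\right)^{N\max_l|A_l|}$. 2. When the test is passed, with significance level $\beta$ the resultant state satisfies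 $$\langle G|\sigma|G\rangle\ge 1-\left[\frac{mh(1-\beta)}{\beta N}+n\sin\frac{\pi}{4h}\right];$$ that is, this inequality holds for every joint state of the $N+1$ systems that passes the test with probability at least $\beta$. -/

import Mathlib

open scoped ComplexOrder

noncomputable section

namespace WGS

/-- A weighted graph on the vertices `Fin n`: an edge set together with symmetric real weights
which vanish off the edges. -/
structure WeightedGraph (n : ℕ) where
  graph : SimpleGraph (Fin n)
  θ : Fin n → Fin n → ℝ
  θ_symm : ∀ j k, θ j k = θ k j
  θ_eq_zero : ∀ j k, ¬ graph.Adj j k → θ j k = 0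

/-- Labels of the computational basis of `n` qubits. -/
abbrev Bits (n : ℕ) : Type := Fin n → Fin 2

/-- Operators on `n` qubits. -/
abbrev Op (n : ℕ) : Type := Matrix (Bits n) (Bits n) ℂ

/-- The rank-one operator `|v⟩⟨v|`. -/
def ketBra {ι : Type} (v : ι → ℂ) : Matrix ι ι ℂ := Matrix.vecMulVec v (star v)

/-- `|0⟩⟨0|` and `|1⟩⟨1|`. -/
def bitProj (b : Fin 2) : Matrix (Fin 2) (Fin 2) ℂ := Matrix.single b b 1

/-- `|α⟩ = (|0⟩ + e^{iα} |1⟩) / √2`. -/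
def ket (α : ℝ) : Fin 2 → ℂ :=
  ![1 / (Real.sqrt 2 : ℂ), Complex.exp (Complex.I * α) / (Real.sqrt 2 : ℂ)]

/-- The single-qubit operator `M` acting on qubit `k` (and the identity on the others). -/
def onQubit {n : ℕ} (k : Fin n) (M : Matrix (Fin 2) (Fin 2) ℂ) : Op n :=
  fun x y => if ∀ j, j ≠ k → x j = y j then M (x k) (y k) else 0

/-- The controlled rotation
`Λ_{jk}(t) = |0⟩⟨0|_j ⊗ I_k + |1⟩⟨1|_j ⊗ (|0⟩⟨0|_k + e^{it} |1⟩⟨1|_k)`. -/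
def gate {n : ℕ} (j k : Fin n) (t : ℝ) : Op n :=
  onQubit j (bitProj 0) +
    onQubit j (bitProj 1) *
      onQubit k (bitProj 0 + Complex.exp (Complex.I * t) • bitProj 1)

/-- The vector `|+⟩^{⊗ n}`. -/
def plusState (n : ℕ) : Bits n → ℂ := fun x => ∏ j, ket 0 (x j)

theorem onQubit_bitProj {n : ℕ} (k : Fin n) (a b : ℂ) :
    onQubit k (a • bitProj 0 + b • bitProj 1) =
      Matrix.diagonal (fun x : Bits n => if x k = 0 then a else b) := by
  ext x y
  have hxy : x = y ↔ (∀ j, j ≠ k → x j = y j) ∧ x k = y k := by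
    constructor
    · rintro rfl; exact ⟨fun _ _ => rfl, rfl⟩
    · rintro ⟨h1, h2⟩
      funext j
      by_cases hj : j = k
      · subst hj; exact h2
      · exact h1 j hj
  rw [Matrix.diagonal_apply]
  simp only [onQubit, hxy]
  by_cases h : ∀ j, j ≠ k → x j = y j
  · rw [if_pos h, if_congr (and_iff_right h) rfl rfl]
    generalize x k = s
    generalize y k = t
    fin_cases s <;> fin_cases t <;> simp [bitProj, Matrix.single]
  · rw [if_neg h, if_neg (fun H => h H.1)]

theorem gate_diagonal {n : ℕ} (j k : Fin n) (t : ℝ) :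
    ∃ d : Bits n → ℂ, gate j k t = Matrix.diagonal d := by
  have h0 := onQubit_bitProj j 1 0
  have h1 := onQubit_bitProj j 0 1
  have h2 := onQubit_bitProj k 1 (Complex.exp (Complex.I * t))
  simp only [one_smul, zero_smul, add_zero, zero_add] at h0 h1 h2
  rw [gate, h0, h1, h2, Matrix.diagonal_mul_diagonal, Matrix.diagonal_add]
  exact ⟨_, rfl⟩

theorem gate_commute {n : ℕ} (j k j' k' : Fin n) (s t : ℝ) :
    Commute (gate j k s) (gate j' k' t) := by
  obtain ⟨d, hd⟩ := gate_diagonal j k s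
  obtain ⟨e, he⟩ := gate_diagonal j' k' t
  rw [hd, he]
  exact Matrix.commute_diagonal d e

open scoped Classical in
/-- The edges, as pairs `(j, k)` with `j < k`. -/
def WeightedGraph.edges {n : ℕ} (G : WeightedGraph n) : Finset (Fin n × Fin n) :=
  Finset.univ.filter (fun e => e.1 < e.2 ∧ G.graph.Adj e.1 e.2)

/-- The weighted graph state `|G⟩`: all the (commuting) gates `Λ_{jk}(θ_{jk})`, one for each edge,
applied to `|+⟩^{⊗ n}`. -/
def WeightedGraph.state {n : ℕ} (G : WeightedGraph n) : Bits n → ℂ :=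
  Matrix.mulVec
    (G.edges.noncommProd (fun e => gate e.1 e.2 (G.θ e.1 e.2))
      (fun _ _ _ _ _ => gate_commute _ _ _ _ _ _))
    (plusState n)

/-- A family `A₁, …, A_m` of independent sets of vertices which covers all the vertices. -/
structure IndependenceCover {n : ℕ} (G : WeightedGraph n) (m : ℕ) where
  A : Fin m → Finset (Fin n)
  indep : ∀ l, ∀ j ∈ A l, ∀ k ∈ A l, ¬ G.graph.Adj j k
  cover : ∀ k, ∃ l, k ∈ A l

/-- Strings of `Z`-basis outcomes on the complement of `A`. -/
abbrev Outcome {n : ℕ} (A : Finset (Fin n)) : Type := {j : Fin n // j ∉ A} → Fin 2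

/-- The projection `|z⟩⟨z|` on the qubits outside `A` (and the identity on the qubits in `A`). -/
def outcomeProj {n : ℕ} (A : Finset (Fin n)) (z : Outcome A) : Op n :=
  Matrix.diagonal (fun x => if ∀ j : {j : Fin n // j ∉ A}, x j = z j then 1 else 0)

open scoped Classical in
/-- The phase `α_k(z) = ∑_{j ∈ C_k} θ_{jk} z_j`, where `C_k` is the set of neighbours of `k`; for
`k` in an independent set `A` all of them lie outside `A`. -/
def WeightedGraph.phase {n : ℕ} (G : WeightedGraph n) (A : Finset (Fin n)) (k : Fin n)
    (z : Outcome A) : ℝ :=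
  ∑ j ∈ Finset.univ.filter (fun j : {j : Fin n // j ∉ A} => G.graph.Adj j k),
    G.θ j k * ((z j : ℕ) : ℝ)

/-- The multiple `r π / h`, with `r` an integer, such that
`r π / h - π / (2 h) ≤ α < r π / h + π / (2 h)`. -/
def roundPhase (h : ℕ) (α : ℝ) : ℝ :=
  (⌊α * h / Real.pi + 1 / 2⌋ : ℝ) * Real.pi / h

/-- The projection `Q_{k;h} = ⊕_z |α^h_k(z)⟩⟨α^h_k(z)|_k ⊗ |z⟩⟨z|`, with `z` running over the
outcome strings outside `A` and the identity on the remaining qubits of `A`. -/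
def WeightedGraph.Q {n : ℕ} (G : WeightedGraph n) (h : ℕ) (A : Finset (Fin n)) (k : Fin n) :
    Op n :=
  ∑ z : Outcome A, onQubit k (ketBra (ket (roundPhase h (G.phase A k z)))) * outcomeProj A z

/-- The factor `(1 / h) Q_{k;h} + ((h - 1) / h) I`. -/
def WeightedGraph.factor {n : ℕ} (G : WeightedGraph n) (h : ℕ) (A : Finset (Fin n))
    (k : Fin n) : Op n :=
  (1 / (h : ℂ)) • G.Q h A k + (((h : ℂ) - 1) / (h : ℂ)) • (1 : Op n)

theorem onQubit_mul_apply {n : ℕ} {k k' : Fin n} (hk : k ≠ k')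
    (M M' : Matrix (Fin 2) (Fin 2) ℂ) (x y : Bits n) :
    (onQubit k M * onQubit k' M') x y =
      if ∀ j, j ≠ k → j ≠ k' → x j = y j then M (x k) (y k) * M' (x k') (y k') else 0 := by
  rw [Matrix.mul_apply, Finset.sum_eq_single (Function.update x k (y k))]
  · have h1 : ∀ j, j ≠ k → x j = Function.update x k (y k) j := fun j hj => by simp [hj]
    have h2 : (∀ j, j ≠ k' → Function.update x k (y k) j = y j) ↔
        ∀ j, j ≠ k → j ≠ k' → x j = y j := by
      constructor
      · intro H j hj hj'
        simpa [hj] using H j hj'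
      · intro H j hj'
        by_cases hj : j = k
        · subst hj; simp
        · simpa [hj] using H j hj hj'
    simp only [onQubit, if_pos h1, h2, Function.update_self,
      Function.update_of_ne hk.symm, mul_ite, mul_zero]
  · intro w _ hw
    by_cases h1 : ∀ j, j ≠ k → x j = w j
    · by_cases h2 : ∀ j, j ≠ k' → w j = y j
      · exact absurd (funext fun j => by
          by_cases hj : j = k
          · subst hj; simp [h2 j hk]
          · simp [hj, h1 j hj]) hw
      · simp [onQubit, h2]
    · simp [onQubit, h1]
  · intro H; exact absurd (Finset.mem_univ _) H

theorem onQubit_commute {n : ℕ} {k k' : Fin n} (hk : k ≠ k')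
    (M M' : Matrix (Fin 2) (Fin 2) ℂ) : Commute (onQubit k M) (onQubit k' M') := by
  ext x y
  rw [onQubit_mul_apply hk, onQubit_mul_apply hk.symm]
  have : (∀ j, j ≠ k → j ≠ k' → x j = y j) ↔ ∀ j, j ≠ k' → j ≠ k → x j = y j :=
    ⟨fun H j a b => H j b a, fun H j a b => H j b a⟩
  simp only [this, mul_comm]

theorem onQubit_commute_outcomeProj {n : ℕ} (A : Finset (Fin n)) {k : Fin n} (hk : k ∈ A)
    (M : Matrix (Fin 2) (Fin 2) ℂ) (z : Outcome A) :
    Commute (onQubit k M) (outcomeProj A z) := by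
  ext x y
  rw [outcomeProj, Matrix.mul_diagonal, Matrix.diagonal_mul]
  by_cases h : ∀ j, j ≠ k → x j = y j
  · have : ∀ j : {j : Fin n // j ∉ A}, x j = y j :=
      fun j => h j (fun e => j.2 (e ▸ hk))
    simp only [this, mul_comm]
  · simp [onQubit, h]

theorem WeightedGraph.factor_commute {n : ℕ} (G : WeightedGraph n) (h : ℕ) (A : Finset (Fin n)) :
    (A : Set (Fin n)).Pairwise (Function.onFun Commute (G.factor h A)) := by
  intro k hk k' hk' hne
  have hQ : Commute (G.Q h A k) (G.Q h A k') := by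
    refine Commute.sum_left _ _ _ fun z _ => Commute.sum_right _ _ _ fun z' _ => ?_
    exact ((onQubit_commute hne _ _).mul_right (onQubit_commute_outcomeProj A hk _ _)).mul_left
      ((onQubit_commute_outcomeProj A hk' _ _).symm.mul_right (Matrix.commute_diagonal _ _))
  exact ((hQ.smul_left _).smul_right _ |>.add_right
      ((Commute.one_right _).smul_right _)).add_left
    (((Commute.one_left _).smul_left _))

/-- `P̄_{l;h} = ∏_{k ∈ A_l} ((1 / h) Q_{k;h} + ((h - 1) / h) I)`, a product of commuting
factors. -/
def WeightedGraph.Pbar {n : ℕ} (G : WeightedGraph n) (h : ℕ) (A : Finset (Fin n)) : Op n :=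
  A.noncommProd (G.factor h A) (G.factor_commute h A)

/-- The test operator `Ω̄_h(𝒜) = ∑_l P̄_{l;h} / m`. -/
def omegaBar {n m : ℕ} {G : WeightedGraph n} (𝒜 : IndependenceCover G m) (h : ℕ) : Op n :=
  ∑ l, (1 / (m : ℂ)) • G.Pbar h (𝒜.A l)

/-- The largest size of a set of the cover. -/
def IndependenceCover.maxCard {n m : ℕ} {G : WeightedGraph n} (𝒜 : IndependenceCover G m) : ℕ :=
  Finset.univ.sup (fun l => (𝒜.A l).card)

section SamplingTest

variable {D : Type} [Fintype D] [DecidableEq D]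

/-- A density matrix. -/
def IsDensity {ι : Type} [Fintype ι] (ρ : Matrix ι ι ℂ) : Prop :=
  ρ.PosSemidef ∧ ρ.trace = 1

/-- The effect "all the copies except copy `i` give the outcome `Ω`":
`Ω` on each copy other than `i` and the identity on copy `i`. -/
def passEffect (N : ℕ) (Ω : Matrix D D ℂ) (i : Fin (N + 1)) :
    Matrix (Fin (N + 1) → D) (Fin (N + 1) → D) ℂ :=
  fun x y => ∏ j, (if j = i then (1 : Matrix D D ℂ) else Ω) (x j) (y j)

/-- The partial trace over all the copies except copy `i`. -/
def reduceTo {N : ℕ} (i : Fin (N + 1))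
    (M : Matrix (Fin (N + 1) → D) (Fin (N + 1) → D) ℂ) : Matrix D D ℂ :=
  fun a b => ∑ w : Fin N → D,
    M (i.insertNth (α := fun _ => D) a w) (i.insertNth (α := fun _ => D) b w)

/-- The probability that the joint state `ρ` of the `N + 1` copies passes the `N`-random sampling
test of `Ω`; the copy `i` that is not measured is uniformly random. -/
def passProb (N : ℕ) (Ω : Matrix D D ℂ)
    (ρ : Matrix (Fin (N + 1) → D) (Fin (N + 1) → D) ℂ) : ℝ :=
  ∑ i : Fin (N + 1), 1 / ((N : ℝ) + 1) * (passEffect N Ω i * ρ).trace.re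

/-- The resultant state: the state of the remaining (uniformly random) copy, conditioned on the
event that the `N`-random sampling test of `Ω` is passed. -/
def resultantState (N : ℕ) (Ω : Matrix D D ℂ)
    (ρ : Matrix (Fin (N + 1) → D) (Fin (N + 1) → D) ℂ) : Matrix D D ℂ :=
  ((passProb N Ω ρ)⁻¹ : ℂ) •
    ∑ i : Fin (N + 1), (1 / ((N : ℂ) + 1)) • reduceTo i (passEffect N Ω i * ρ)

/-- The pure state `|ψ⟩^{⊗ (N+1)}`, as a density matrix. -/
def copies (N : ℕ) (ψ : D → ℂ) : Matrix (Fin (N + 1) → D) (Fin (N + 1) → D) ℂ :=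
  ketBra (fun x => ∏ j, ψ (x j))

/-- The fidelity `⟨ψ|σ|ψ⟩`. -/
def fidelity (ψ : D → ℂ) (σ : Matrix D D ℂ) : ℝ := (star ψ ⬝ᵥ σ.mulVec ψ).re

end SamplingTest

end WGS

end

/-! Fidelity bound. Let `p` be the probability of passing and `g` the probability that all `N + 1`
copies would be accepted. Simultaneous diagonalization of the effects on the copies reduces `(N + 1)
p ≤ 1 + N g` to a multi-affine inequality on the unit cube (`sum_prod_erase_le`,
`one_sub_sum_passEffect_posSemidef`). So the remaining copy, given passing, is rejected by `Ω` with
probability `(p - g) / p ≤ (1 - p) / (N p) ≤ (1 - β) / (N β)`. An operator inequality `1 - |ψ⟩⟨ψ| ≤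
c (1 - Ω) + s` then converts rejection into infidelity (`le_fidelity_resultantState`).

For the test at hand this inequality, with `c = m h` and `s = n sin (π / 4h)`, is `infidelity_le`.
Without rounding, every factor is diagonal in the graph basis, with eigenvalue `1` or `(h - 1) / h`
according to bit `k` of the label, and `|G⟩` has label `0`. A nonzero label has a nonzero bit in
some `A_l`, which costs at least `1 / h` there (`sum_one_sub_exactPbar`). Rounding moves a factor by
at most `sin (π / 4h) / h` in operator norm, hence `P̄_l` by at most `|A_l|` times that
(`Pbar_sub_exactPbar_le`); multiplied by `h` and summed over disjoint sets, the errors total at most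
`n sin (π / 4h)`.

Passing bound. Applied to `|G⟩`, a factor multiplies each amplitude by a number depending on bit `k`
and on the rounding error of `α_k` (`factor_mulVec`). That error depends only on the bits outside
`A_l`, so the bits inside can be averaged one at a time, each giving `1 - sin² (δ / 2) / h`
(`sum_prod_amplitudeFactor`). -/

noncomputable section

namespace WGS

open Matrix
open scoped MatrixOrder Matrix.Norms.L2Operator

/-! ### Tensor products of operators -/

section TensorProd

variable {ι D : Type} [Fintype ι]

/-- The tensor product of the operators `M j` on the copies `j` of a system. -/
def tensorProd (M : ι → Matrix D D ℂ) : Matrix (ι → D) (ι → D) ℂ :=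
  fun x y => ∏ j, M j (x j) (y j)

theorem tensorProd_mul [DecidableEq ι] [Fintype D] (M M' : ι → Matrix D D ℂ) :
    tensorProd M * tensorProd M' = tensorProd (fun j => M j * M' j) := by
  ext x y
  simp only [tensorProd, Matrix.mul_apply, ← Finset.prod_mul_distrib]
  rw [Finset.prod_univ_sum, Fintype.piFinset_univ]

theorem tensorProd_conjTranspose (M : ι → Matrix D D ℂ) :
    (tensorProd M)ᴴ = tensorProd (fun j => (M j)ᴴ) := by
  ext x y
  simp [tensorProd, Matrix.conjTranspose_apply]

theorem tensorProd_diagonal [DecidableEq ι] [DecidableEq D] (d : ι → D → ℂ) :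
    tensorProd (fun j => diagonal (d j)) = diagonal (fun x => ∏ j, d j (x j)) := by
  ext x y
  rw [diagonal_apply]
  split_ifs with hxy
  · subst hxy; simp [tensorProd]
  · obtain ⟨j, hj⟩ := Function.ne_iff.mp hxy
    exact Finset.prod_eq_zero (Finset.mem_univ j) (by simp [hj])

theorem tensorProd_one [DecidableEq ι] [DecidableEq D] :
    tensorProd (fun _ : ι => (1 : Matrix D D ℂ)) = 1 := by
  simpa using tensorProd_diagonal (fun (_ : ι) (_ : D) => (1 : ℂ))

theorem tensorProd_posSemidef [DecidableEq ι] [Fintype D] [DecidableEq D]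
    {M : ι → Matrix D D ℂ} (hM : ∀ j, (M j).PosSemidef) : (tensorProd M).PosSemidef := by
  choose B hB using fun j => CStarAlgebra.nonneg_iff_eq_star_mul_self.mp (hM j).nonneg
  have : tensorProd M = (tensorProd B)ᴴ * tensorProd B := by
    rw [tensorProd_conjTranspose, tensorProd_mul]
    exact congrArg tensorProd (funext hB)
  rw [this]
  exact posSemidef_conjTranspose_mul_self _

end TensorProd

/-! ### Random sampling of an arbitrary test operator -/

theorem trace_mul_re_nonneg {ι : Type} [Fintype ι] [DecidableEq ι] {A B : Matrix ι ι ℂ}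
    (hA : A.PosSemidef) (hB : B.PosSemidef) : 0 ≤ (A * B).trace.re := by
  obtain ⟨C, rfl⟩ := CStarAlgebra.nonneg_iff_eq_star_mul_self.mp hA.nonneg
  rw [Matrix.mul_assoc, Matrix.trace_mul_comm]
  exact (Complex.le_def.mp (hB.mul_mul_conjTranspose_same C).trace_nonneg).1

/-- A multi-affine inequality on the unit cube. -/
theorem sum_prod_erase_le {ι : Type} [DecidableEq ι] (s : Finset ι) (t : ι → ℝ)
    (h0 : ∀ j, 0 ≤ t j) (h1 : ∀ j, t j ≤ 1) :
    ∑ i ∈ s, ∏ j ∈ s, (if j = i then 1 else t j) ≤ 1 + ((s.card : ℝ) - 1) * ∏ j ∈ s, t j := by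
  induction s using Finset.induction_on with
  | empty => simp
  | insert a s ha ih =>
    have e1 : ∏ j ∈ insert a s, (if j = a then 1 else t j) = ∏ j ∈ s, t j := by
      rw [Finset.prod_insert ha, if_pos rfl, one_mul]
      exact Finset.prod_congr rfl fun j hj => if_neg (ne_of_mem_of_not_mem hj ha)
    have e2 : ∀ i ∈ s, ∏ j ∈ insert a s, (if j = i then 1 else t j) =
        t a * ∏ j ∈ s, (if j = i then 1 else t j) := by
      intro i hi
      rw [Finset.prod_insert ha, if_neg (ne_of_mem_of_not_mem hi ha).symm]
    rw [Finset.sum_insert ha, e1, Finset.sum_congr rfl e2, ← Finset.mul_sum,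
      Finset.card_insert_of_notMem ha, Finset.prod_insert ha]
    have hp : ∏ j ∈ s, t j ≤ 1 := Finset.prod_le_one (fun j _ => h0 j) (fun j _ => h1 j)
    have := mul_le_mul_of_nonneg_left ih (h0 a)
    push_cast
    -- With `P` the product over `s`, the induction step comes down to `P + t a - t a * P ≤ 1`, that
    -- is `0 ≤ (1 - t a) * (1 - P)`.
    nlinarith [mul_nonneg (sub_nonneg.mpr (h1 a)) (sub_nonneg.mpr hp)]

section Sampling

variable {D : Type} [Fintype D] [DecidableEq D]

omit [Fintype D] in
theorem passEffect_eq_tensorProd (N : ℕ) (Ω : Matrix D D ℂ) (i : Fin (N + 1)) :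
    passEffect N Ω i = tensorProd (fun j => if j = i then 1 else Ω) := rfl

/-- All the operators involved are tensor products of `1` and `Ω`, so a tensor power of an
eigenbasis of `Ω` diagonalizes them at once. The eigenvalues are controlled by `sum_prod_erase_le`.
No symmetry or product form of the joint state is needed later, because this is an operator
inequality. -/
theorem one_sub_sum_passEffect_posSemidef (N : ℕ) {Ω : Matrix D D ℂ} (h0 : Ω.PosSemidef)
    (h1 : (1 - Ω).PosSemidef) :
    (1 - ∑ i, passEffect N Ω i +
      (N : ℂ) • tensorProd (fun _ : Fin (N + 1) => Ω)).PosSemidef := by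
  set U : Matrix D D ℂ := (h0.1.eigenvectorUnitary : Matrix D D ℂ) with hU
  set t := h0.1.eigenvalues with ht
  have hUU : U * Uᴴ = 1 := by
    simpa [star_eq_conjTranspose] using Unitary.coe_mul_star_self h0.1.eigenvectorUnitary
  have hUU' : Uᴴ * U = 1 := by
    simpa [star_eq_conjTranspose] using Unitary.coe_star_mul_self h0.1.eigenvectorUnitary
  have hΩ : Ω = U * diagonal (fun j => (t j : ℂ)) * Uᴴ := by
    have := h0.1.spectral_theorem
    rw [Unitary.conjStarAlgAut_apply] at this
    simpa [star_eq_conjTranspose, Function.comp_def] using this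
  have ht0 : ∀ j, 0 ≤ t j := h0.eigenvalues_nonneg
  have ht1 : ∀ j, t j ≤ 1 := by
    have e : Uᴴ * (1 - Ω) * U = diagonal (fun j => 1 - (t j : ℂ)) := by
      rw [hΩ, Matrix.mul_sub, Matrix.sub_mul, Matrix.mul_one, hUU']
      have : Uᴴ * (U * diagonal (fun j => (t j : ℂ)) * Uᴴ) * U =
          (Uᴴ * U) * diagonal (fun j => (t j : ℂ)) * (Uᴴ * U) := by simp only [Matrix.mul_assoc]
      rw [this, hUU', Matrix.one_mul, Matrix.mul_one, ← diagonal_one, diagonal_sub]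
    have := h1.conjTranspose_mul_mul_same U
    rw [e, posSemidef_diagonal_iff] at this
    intro j
    have := (Complex.le_def.mp (this j)).1
    simpa using this
  have key : ∀ d : Fin (N + 1) → D → ℂ, tensorProd (fun j => U * diagonal (d j) * Uᴴ) =
      tensorProd (fun _ : Fin (N + 1) => U) * diagonal (fun x => ∏ j, d j (x j)) *
        (tensorProd (fun _ : Fin (N + 1) => U))ᴴ := by
    intro d
    rw [tensorProd_conjTranspose, ← tensorProd_diagonal, tensorProd_mul, tensorProd_mul]
  have e1 : (1 : Matrix (Fin (N + 1) → D) (Fin (N + 1) → D) ℂ) =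
      tensorProd (fun _ : Fin (N + 1) => U) * 1 * (tensorProd (fun _ : Fin (N + 1) => U))ᴴ := by
    rw [tensorProd_conjTranspose, Matrix.mul_one, tensorProd_mul, hUU, tensorProd_one]
  have e2 : ∀ i, passEffect N Ω i = tensorProd (fun _ : Fin (N + 1) => U) *
      diagonal (fun x => ∏ j, if j = i then 1 else (t (x j) : ℂ)) *
        (tensorProd (fun _ : Fin (N + 1) => U))ᴴ := by
    intro i
    have := key (fun j b => if j = i then 1 else (t b : ℂ))
    rw [← this, passEffect_eq_tensorProd]
    congr 1
    funext j
    split_ifs with hj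
    · simp [hUU]
    · exact hΩ
  have e3 : tensorProd (fun _ : Fin (N + 1) => Ω) = tensorProd (fun _ : Fin (N + 1) => U) *
      diagonal (fun x => ∏ j, (t (x j) : ℂ)) * (tensorProd (fun _ : Fin (N + 1) => U))ᴴ := by
    rw [← key (fun _ b => (t b : ℂ))]
    exact congrArg tensorProd (funext fun _ => hΩ)
  simp only [e2]
  rw [e3, ← Finset.sum_mul, ← Finset.mul_sum, e1, ← Matrix.sub_mul, ← Matrix.mul_sub,
    ← Matrix.smul_mul, ← Matrix.mul_smul, ← Matrix.add_mul, ← Matrix.mul_add]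
  refine Matrix.PosSemidef.mul_mul_conjTranspose_same ?_ _
  have e4 : (1 - ∑ i : Fin (N + 1),
        diagonal (fun x : Fin (N + 1) → D => ∏ j, if j = i then 1 else (t (x j) : ℂ)) +
      (N : ℂ) • diagonal (fun x : Fin (N + 1) → D => ∏ j, (t (x j) : ℂ))) =
      diagonal (fun x : Fin (N + 1) → D => ((1 -
        ∑ i : Fin (N + 1), ∏ j, (if j = i then 1 else t (x j)) + N * ∏ j, t (x j) : ℝ) : ℂ)) := by
    ext x y
    rcases eq_or_ne x y with rfl | hxy
    · simp [Matrix.sum_apply, apply_ite Complex.ofReal]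
    · simp [Matrix.sum_apply, hxy]
  rw [e4, posSemidef_diagonal_iff]
  intro x
  rw [Complex.zero_le_real]
  have := sum_prod_erase_le Finset.univ (fun j : Fin (N + 1) => t (x j)) (fun _ => ht0 _)
    (fun _ => ht1 _)
  simp only [Finset.card_univ, Fintype.card_fin, Nat.cast_add, Nat.cast_one,
    add_sub_cancel_right] at this
  linarith

/-- The effect is the identity on copy `i`, so testing the reduced operator against `X` amounts to
putting `X` into the vacant slot. This makes the fidelity comparable with the acceptance
probabilities. -/
theorem trace_mul_reduceTo (N : ℕ) (Ω X : Matrix D D ℂ) (i : Fin (N + 1))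
    (ρ : Matrix (Fin (N + 1) → D) (Fin (N + 1) → D) ℂ) :
    (X * reduceTo i (passEffect N Ω i * ρ)).trace =
      (tensorProd (fun j => if j = i then X else Ω) * ρ).trace := by
  have split : ∀ (Y : Matrix D D ℂ) (a : D) (w : Fin N → D) (y : Fin (N + 1) → D),
      tensorProd (fun j => if j = i then Y else Ω) (i.insertNth (α := fun _ => D) a w) y =
        Y a (y i) * ∏ j, Ω (w j) (y (i.succAbove j)) := by
    intro Y a w y
    rw [tensorProd, Fin.prod_univ_succAbove _ i]
    simp [Fin.succAbove_ne]
  simp only [Matrix.trace, Matrix.diag_apply]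
  rw [← (Fin.insertNthEquiv (fun _ => D) i).sum_comp, Fintype.sum_prod_type]
  refine Finset.sum_congr rfl fun a _ => ?_
  change _ = ∑ w, (tensorProd (fun j => if j = i then X else Ω) * ρ)
    (i.insertNth (α := fun _ => D) a w) (i.insertNth (α := fun _ => D) a w)
  simp only [Matrix.mul_apply, reduceTo, passEffect_eq_tensorProd, split, Finset.mul_sum]
  rw [Finset.sum_comm]
  refine Finset.sum_congr rfl fun w _ => ?_
  rw [Finset.sum_comm]
  refine Finset.sum_congr rfl fun y _ => ?_
  rw [Finset.sum_eq_single (y i)]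
  · simp; ring
  · intro b _ hb; simp [hb]
  · simp

omit [DecidableEq D] in
theorem fidelity_eq_trace (ψ : D → ℂ) (σ : Matrix D D ℂ) :
    fidelity ψ σ = (ketBra ψ * σ).trace.re := by
  rw [fidelity, ketBra, Matrix.trace_mul_comm, Matrix.mul_vecMulVec, Matrix.trace_vecMulVec,
    dotProduct_comm]

/-- If `Ω` accepts `ψ` almost exclusively, then the resultant state of the `N`-random sampling test
of `Ω` is close to `ψ`. -/
theorem le_fidelity_resultantState {N : ℕ} (hN : 0 < N) {Ω : Matrix D D ℂ} (h0 : Ω.PosSemidef)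
    (h1 : (1 - Ω).PosSemidef) (ψ : D → ℂ) {c s : ℝ} (hc : 0 ≤ c)
    (hψ : ((c : ℂ) • (1 - Ω) + (s : ℂ) • (1 : Matrix D D ℂ) - (1 - ketBra ψ)).PosSemidef)
    {ρ : Matrix (Fin (N + 1) → D) (Fin (N + 1) → D) ℂ} (hρ : IsDensity ρ) {β : ℝ} (hβ : 0 < β)
    (hpass : β ≤ passProb N Ω ρ) :
    1 - (c * (1 - β) / (β * N) + s) ≤ fidelity ψ (resultantState N Ω ρ) := by
  set p := passProb N Ω ρ with hp
  have hp0 : 0 < p := hβ.trans_le hpass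
  have hN' : (0 : ℝ) < N := Nat.cast_pos.mpr hN
  set T : Matrix D D ℂ → Fin (N + 1) → Matrix (Fin (N + 1) → D) (Fin (N + 1) → D) ℂ :=
    fun X i => tensorProd (fun j => if j = i then X else Ω) with hT
  -- The unnormalized expectation of `X` on the remaining copy, jointly with passing. It is linear
  -- and positive in `X`.
  set F : Matrix D D ℂ → ℝ := fun X =>
    ∑ i : Fin (N + 1), 1 / ((N : ℝ) + 1) * (T X i * ρ).trace.re with hF
  set g : ℝ := (tensorProd (fun _ : Fin (N + 1) => Ω) * ρ).trace.re with hg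
  have hF1 : F 1 = p := rfl
  -- With `Ω` in the vacant slot as well, the choice of `i` no longer matters.
  have hFΩ : F Ω = g := by
    have : (N : ℝ) + 1 ≠ 0 := by positivity
    simp [hF, hT, hg]
    field_simp
  have hfid : fidelity ψ (resultantState N Ω ρ) = p⁻¹ * F (ketBra ψ) := by
    rw [fidelity_eq_trace, resultantState, Matrix.mul_smul, Matrix.trace_smul, Finset.mul_sum,
      Matrix.trace_sum, ← hp, smul_eq_mul, ← Complex.ofReal_inv, Complex.re_ofReal_mul,
      Complex.re_sum]
    congr 1
    refine Finset.sum_congr rfl fun i _ => ?_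
    rw [Matrix.mul_smul, Matrix.trace_smul, trace_mul_reduceTo, smul_eq_mul]
    have : (1 : ℂ) / ((N : ℂ) + 1) = ((1 / ((N : ℝ) + 1) : ℝ) : ℂ) := by push_cast; rfl
    rw [this, Complex.re_ofReal_mul]
  have hFpos : ∀ X : Matrix D D ℂ, X.PosSemidef → 0 ≤ F X := by
    intro X hX
    refine Finset.sum_nonneg fun i _ => mul_nonneg (by positivity) ?_
    refine trace_mul_re_nonneg (tensorProd_posSemidef fun j => ?_) hρ.1
    split_ifs <;> assumption
  have hTlin : ∀ (a b d : ℝ) (i : Fin (N + 1)) (X Y Z : Matrix D D ℂ),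
      T ((a : ℂ) • X + (b : ℂ) • Y + (d : ℂ) • Z) i =
        (a : ℂ) • T X i + (b : ℂ) • T Y i + (d : ℂ) • T Z i := by
    intro a b d i X Y Z
    ext x y
    simp only [hT, tensorProd, Matrix.add_apply, Matrix.smul_apply, smul_eq_mul]
    simp only [← Finset.mul_prod_erase _ _ (Finset.mem_univ i), if_true, Matrix.add_apply,
      Matrix.smul_apply, smul_eq_mul]
    have : ∀ W : Matrix D D ℂ, ∏ j ∈ Finset.univ.erase i, (if j = i then W else Ω) (x j) (y j) =
        ∏ j ∈ Finset.univ.erase i, Ω (x j) (y j) := fun W =>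
      Finset.prod_congr rfl fun j hj => by rw [if_neg (Finset.ne_of_mem_erase hj)]
    simp only [this]
    ring
  have hFlin : F ((c : ℂ) • (1 - Ω) + (s : ℂ) • (1 : Matrix D D ℂ) - (1 - ketBra ψ)) =
      c * (p - g) + s * p - p + F (ketBra ψ) := by
    have e : (c : ℂ) • (1 - Ω) + (s : ℂ) • (1 : Matrix D D ℂ) - (1 - ketBra ψ) =
        ((c + s - 1 : ℝ) : ℂ) • (1 : Matrix D D ℂ) + ((-c : ℝ) : ℂ) • Ω +
          ((1 : ℝ) : ℂ) • ketBra ψ := by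
      push_cast
      module
    have lin : ∀ (a b d : ℝ) (X Y Z : Matrix D D ℂ),
        F ((a : ℂ) • X + (b : ℂ) • Y + (d : ℂ) • Z) = a * F X + b * F Y + d * F Z := by
      intro a b d X Y Z
      simp only [hF, hTlin, Finset.mul_sum, ← Finset.sum_add_distrib]
      refine Finset.sum_congr rfl fun i _ => ?_
      simp only [Matrix.add_mul, Matrix.smul_mul, Matrix.trace_add, Matrix.trace_smul,
        smul_eq_mul, Complex.add_re, Complex.re_ofReal_mul]
      ring
    rw [e, lin, hF1, hFΩ]
    ring
  have h2 := hFpos _ hψ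
  rw [hFlin] at h2
  have h3 : ((N : ℝ) + 1) * p ≤ 1 + N * g := by
    have := trace_mul_re_nonneg (one_sub_sum_passEffect_posSemidef N h0 h1) hρ.1
    rw [Matrix.add_mul, Matrix.sub_mul, Matrix.one_mul, Matrix.trace_add, Matrix.trace_sub, hρ.2,
      Finset.sum_mul, Matrix.trace_sum, Matrix.smul_mul, Matrix.trace_smul, smul_eq_mul,
      Complex.add_re, Complex.sub_re, Complex.re_sum, ← Complex.ofReal_natCast,
      Complex.re_ofReal_mul, ← hg] at this
    have hp' : ((N : ℝ) + 1) * p = ∑ i, (passEffect N Ω i * ρ).trace.re := by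
      have : (N : ℝ) + 1 ≠ 0 := by positivity
      rw [hp, passProb, ← Finset.mul_sum]
      field_simp
    rw [hp']
    simp only [Complex.one_re] at this
    linarith
  -- By `h3`, `N (p - g) ≤ 1 - p`, and `β (1 - p) ≤ p (1 - β)` because `β ≤ p`.
  have h4 : (p - g) / p ≤ (1 - β) / (β * N) := by
    rw [div_le_div_iff₀ hp0 (by positivity)]
    nlinarith [mul_le_mul_of_nonneg_left h3 hβ.le]
  have h5 : p⁻¹ * F (ketBra ψ) ≥ 1 - (c * ((p - g) / p) + s) := by
    have : 1 - (c * ((p - g) / p) + s) = p⁻¹ * (p - (c * (p - g) + s * p)) := by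
      field_simp
    rw [this]
    exact mul_le_mul_of_nonneg_left (by linarith) (by positivity)
  have h6 := mul_le_mul_of_nonneg_left h4 hc
  rw [hfid, mul_div_assoc]
  linarith

end Sampling

/-! ### Products of commuting contractions, positive elements and diagonalizable operators -/

section NormedRing

variable {R κ : Type*} [NormedRing R] [NormOneClass R]

theorem norm_noncommProd_le_one (s : Finset κ) (f : κ → R) (hf : ∀ k ∈ s, ‖f k‖ ≤ 1)
    (comm : (s : Set κ).Pairwise (Function.onFun Commute f)) : ‖s.noncommProd f comm‖ ≤ 1 :=
  Finset.noncommProd_induction s f comm (fun a => ‖a‖ ≤ 1)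
    (fun a b ha hb => (norm_mul_le a b).trans (mul_le_one₀ ha (norm_nonneg b) hb))
    norm_one.le hf

/-- Telescoping: the factors are exchanged one at a time, and the contractions on either side do not
enlarge the error. -/
theorem norm_noncommProd_sub_le [DecidableEq κ] (s : Finset κ) (f g : κ → R)
    (hf : ∀ k ∈ s, ‖f k‖ ≤ 1) (hg : ∀ k ∈ s, ‖g k‖ ≤ 1)
    (cf : (s : Set κ).Pairwise (Function.onFun Commute f))
    (cg : (s : Set κ).Pairwise (Function.onFun Commute g)) :
    ‖s.noncommProd f cf - s.noncommProd g cg‖ ≤ ∑ k ∈ s, ‖f k - g k‖ := by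
  induction s using Finset.induction_on with
  | empty => simp
  | insert a s ha ih =>
    have hs : ∀ k ∈ s, k ∈ insert a s := fun k => Finset.mem_insert_of_mem
    have cf' := cf.mono (fun k hk => by simpa using hs k hk : (s : Set κ) ⊆ ↑(insert a s))
    have cg' := cg.mono (fun k hk => by simpa using hs k hk : (s : Set κ) ⊆ ↑(insert a s))
    rw [Finset.noncommProd_insert_of_notMem _ _ _ _ ha,
      Finset.noncommProd_insert_of_notMem _ _ _ _ ha, Finset.sum_insert ha]
    set F := s.noncommProd f cf'
    set H := s.noncommProd g cg'
    have e : f a * F - g a * H = (f a - g a) * F + g a * (F - H) := by noncomm_ring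
    have hF : ‖F‖ ≤ 1 := norm_noncommProd_le_one s f (fun k hk => hf k (hs k hk)) cf'
    have hH := ih (fun k hk => hf k (hs k hk)) (fun k hk => hg k (hs k hk)) cf' cg'
    rw [e]
    refine (norm_add_le _ _).trans (add_le_add ?_ ?_)
    · exact (norm_mul_le _ _).trans (mul_le_of_le_one_right (norm_nonneg _) hF)
    · exact (norm_mul_le _ _).trans ((mul_le_of_le_one_left (norm_nonneg _)
        (hg a (Finset.mem_insert_self _ _))).trans hH)

end NormedRing

theorem noncommProd_nonneg {R κ : Type*} [CStarAlgebra R] [PartialOrder R] [StarOrderedRing R]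
    [DecidableEq κ] (s : Finset κ) (f : κ → R) (hf : ∀ k ∈ s, 0 ≤ f k)
    (comm : (s : Set κ).Pairwise (Function.onFun Commute f)) : 0 ≤ s.noncommProd f comm := by
  induction s using Finset.induction_on with
  | empty => simp
  | insert a s ha ih =>
    rw [Finset.noncommProd_insert_of_notMem _ _ _ _ ha]
    refine Commute.mul_nonneg (hf a (Finset.mem_insert_self _ _))
      (ih (fun k hk => hf k (Finset.mem_insert_of_mem hk)) _) ?_
    refine Finset.noncommProd_commute _ _ _ _ fun k hk => ?_
    exact comm (by simp) (by simp [hk]) (ne_of_mem_of_not_mem hk ha).symm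

theorem noncommProd_conj_diagonal {ι κ : Type} [Fintype ι] [DecidableEq ι] [DecidableEq κ]
    {V : Matrix ι ι ℂ} (hV : V * Vᴴ = 1) (d : κ → ι → ℂ) (s : Finset κ)
    (comm : (s : Set κ).Pairwise (Function.onFun Commute fun k => V * diagonal (d k) * Vᴴ)) :
    s.noncommProd (fun k => V * diagonal (d k) * Vᴴ) comm =
      V * diagonal (fun x => ∏ k ∈ s, d k x) * Vᴴ := by
  have hV' : Vᴴ * V = 1 := mul_eq_one_comm.mp hV
  induction s using Finset.induction_on with
  | empty => simp [hV]
  | insert a s ha ih =>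
    rw [Finset.noncommProd_insert_of_notMem _ _ _ _ ha, ih]
    have : V * diagonal (d a) * Vᴴ * (V * diagonal (fun x => ∏ k ∈ s, d k x) * Vᴴ) =
        V * (diagonal (d a) * (Vᴴ * V) * diagonal (fun x => ∏ k ∈ s, d k x)) * Vᴴ := by
      simp only [Matrix.mul_assoc]
    rw [this, hV', Matrix.mul_one, diagonal_mul_diagonal]
    simp only [Finset.prod_insert ha]

theorem commute_conj_diagonal {ι : Type} [Fintype ι] [DecidableEq ι]
    {V : Matrix ι ι ℂ} (hV : V * Vᴴ = 1) (d e : ι → ℂ) :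
    Commute (V * diagonal d * Vᴴ) (V * diagonal e * Vᴴ) := by
  have hV' : Vᴴ * V = 1 := mul_eq_one_comm.mp hV
  have : ∀ d e : ι → ℂ, V * diagonal d * Vᴴ * (V * diagonal e * Vᴴ) =
      V * (diagonal d * (Vᴴ * V) * diagonal e) * Vᴴ := fun d e => by
    simp only [Matrix.mul_assoc]
  rw [Commute, SemiconjBy, this, this, hV', Matrix.mul_one, Matrix.mul_one,
    diagonal_mul_diagonal, diagonal_mul_diagonal]
  simp only [mul_comm]

/-! ### Controlled single-qubit operators -/

/-- A controlled operator on qubit `k`: the operator `M x` acts on qubit `k`, where `x` is the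
string of the bits of all the qubits; `M x` is meant not to depend on the bit of `k` itself. -/
def ctrl {n : ℕ} (k : Fin n) (M : Bits n → Matrix (Fin 2) (Fin 2) ℂ) : Op n :=
  fun x y => if ∀ j, j ≠ k → x j = y j then M x (x k) (y k) else 0

section Ctrl

variable {n : ℕ} {k : Fin n} {M M' : Bits n → Matrix (Fin 2) (Fin 2) ℂ}

theorem agree_iff_exists_update (k : Fin n) (x y : Bits n) :
    (∀ j, j ≠ k → x j = y j) ↔ y = Function.update x k (y k) := by
  constructor
  · intro H
    funext j
    by_cases hj : j = k
    · subst hj; simp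
    · simp [hj, H j hj]
  · intro H j hj
    rw [H]
    simp [hj]

theorem sum_agree (k : Fin n) (x : Bits n) (f : Bits n → ℂ) :
    ∑ y, (if ∀ j, j ≠ k → x j = y j then f y else 0) = ∑ b, f (Function.update x k b) := by
  rw [← Finset.sum_filter]
  symm
  refine Finset.sum_bij (fun b _ => Function.update x k b) ?_ ?_ ?_ ?_
  · intro b _
    simp only [Finset.mem_filter, Finset.mem_univ, true_and]
    intro j hj
    simp [hj]
  · intro b _ b' _ H
    simpa using congrFun H k
  · intro y hy
    exact ⟨y k, Finset.mem_univ _,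
      ((agree_iff_exists_update k x y).mp (Finset.mem_filter.mp hy).2).symm⟩
  · intros; rfl

theorem ctrl_mulVec (w : Bits n → ℂ) (x : Bits n) :
    (ctrl k M).mulVec w x = ∑ b, M x (x k) b * w (Function.update x k b) := by
  simp only [Matrix.mulVec, dotProduct, ctrl, ite_mul, zero_mul]
  rw [sum_agree]
  simp

theorem ctrl_mul (hM' : ∀ x b, M' (Function.update x k b) = M' x) :
    ctrl k M * ctrl k M' = ctrl k (fun x => M x * M' x) := by
  ext x y
  simp only [Matrix.mul_apply, ctrl, ite_mul, zero_mul]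
  rw [sum_agree]
  have : ∀ b, (∀ j, j ≠ k → Function.update x k b j = y j) ↔ ∀ j, j ≠ k → x j = y j := by
    intro b
    refine forall₂_congr fun j hj => ?_
    simp [hj]
  simp only [this, hM', Function.update_self]
  split_ifs <;> simp

theorem ctrl_conjTranspose (hM : ∀ x b, M (Function.update x k b) = M x) :
    (ctrl k M)ᴴ = ctrl k (fun x => (M x)ᴴ) := by
  ext x y
  simp only [Matrix.conjTranspose_apply, ctrl]
  have : (∀ j, j ≠ k → y j = x j) ↔ ∀ j, j ≠ k → x j = y j := by simp only [eq_comm]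
  simp only [this]
  split_ifs with H
  · rw [(agree_iff_exists_update k x y).mp H, hM]
  · simp

theorem ctrl_sub : ctrl k M - ctrl k M' = ctrl k (fun x => M x - M' x) := by
  ext x y
  simp only [Matrix.sub_apply, ctrl]
  split_ifs <;> simp

theorem ctrl_smul_one (c : Bits n → ℂ) : ctrl k (fun x => c x • 1) = diagonal c := by
  ext x y
  have hxy : x = y ↔ (∀ j, j ≠ k → x j = y j) ∧ x k = y k := by
    constructor
    · rintro rfl; exact ⟨fun _ _ => rfl, rfl⟩
    · rintro ⟨h1, h2⟩
      rw [(agree_iff_exists_update k x y).mp h1, ← h2, Function.update_eq_self]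
  rw [diagonal_apply]
  simp only [ctrl, hxy, ite_and, Matrix.smul_apply, Matrix.one_apply, smul_eq_mul, mul_ite,
    mul_one, mul_zero]

/-- By the C*-identity the squared norm is that of `(ctrl k M)ᴴ * ctrl k M`, which is diagonal
because each block `(M x)ᴴ * M x` is a scalar. -/
theorem norm_ctrl_le (hM : ∀ x b, M (Function.update x k b) = M x) {s : ℝ} (hs : 0 ≤ s)
    (c : Bits n → ℝ) (hc : ∀ x, |c x| ≤ s) (h : ∀ x, (M x)ᴴ * M x = ((c x ^ 2 : ℝ) : ℂ) • 1) :
    ‖ctrl k M‖ ≤ s := by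
  have e : (ctrl k M)ᴴ * ctrl k M = diagonal (fun x => ((c x ^ 2 : ℝ) : ℂ)) := by
    rw [ctrl_conjTranspose hM, ctrl_mul hM]
    simp only [h]
    exact ctrl_smul_one _
  have h2 : ‖ctrl k M‖ * ‖ctrl k M‖ ≤ s * s := by
    rw [← l2_opNorm_conjTranspose_mul_self, e, l2_opNorm_diagonal]
    refine (pi_norm_le_iff_of_nonneg (by positivity)).mpr fun x => ?_
    rw [Complex.norm_real, Real.norm_eq_abs, abs_pow, pow_two]
    exact mul_self_le_mul_self (abs_nonneg _) (hc x)
  exact abs_le_of_sq_le_sq' (by nlinarith) hs |>.2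

end Ctrl

/-! ### The equatorial states of one qubit -/

theorem ketBra_ket_apply (a : ℝ) (p q : Fin 2) :
    ketBra (ket a) p q =
      Complex.exp (Complex.I * ((a * (((p : ℕ) : ℝ) - ((q : ℕ) : ℝ)) : ℝ) : ℂ)) / 2 := by
  have h2 : (Real.sqrt 2 : ℂ) * (Real.sqrt 2 : ℂ) = 2 := by
    rw [← Complex.ofReal_mul, Real.mul_self_sqrt (by norm_num)]; norm_num
  have h3 : (Real.sqrt 2 : ℂ)⁻¹ * (Real.sqrt 2 : ℂ)⁻¹ = 2⁻¹ := by rw [← mul_inv, h2]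
  have hc : (starRingEnd ℂ) (Complex.exp (Complex.I * a)) = Complex.exp (-(Complex.I * a)) := by
    rw [← Complex.exp_conj]; simp
  have he : Complex.exp (Complex.I * a) * Complex.exp (-(Complex.I * a)) = 1 := by
    rw [← Complex.exp_add]; simp
  fin_cases p <;> fin_cases q <;>
    simp [ketBra, ket, Matrix.vecMulVec_apply, hc, div_eq_mul_inv]
  · exact h3
  · linear_combination Complex.exp (-(Complex.I * a)) * h3
  · linear_combination Complex.exp (Complex.I * a) * h3
  · linear_combination (Complex.exp (Complex.I * a) * Complex.exp (-(Complex.I * a))) * h3 +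
      2⁻¹ * he

theorem star_ket_dotProduct_ket (a : ℝ) : star (ket a) ⬝ᵥ ket a = 1 := by
  have h0 := ketBra_ket_apply a 0 0
  have h1 := ketBra_ket_apply a 1 1
  simp only [ketBra, Matrix.vecMulVec_apply, Pi.star_apply, sub_self, mul_zero, Complex.ofReal_zero,
    Complex.exp_zero] at h0 h1
  rw [dotProduct_comm]
  simp only [dotProduct, Fin.sum_univ_two, Pi.star_apply]
  rw [h0, h1]
  norm_num

theorem ketBra_mul_self {ι : Type} [Fintype ι] {v : ι → ℂ} (hv : star v ⬝ᵥ v = 1) :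
    ketBra v * ketBra v = ketBra v := by
  rw [ketBra, Matrix.vecMulVec_mul_vecMulVec, hv, one_smul]

theorem ketBra_conjTranspose {ι : Type} (v : ι → ℂ) : (ketBra v)ᴴ = ketBra v := by
  ext i j
  simp [ketBra, Matrix.vecMulVec_apply, mul_comm]

/-- The difference of two pure qubit projections is traceless and Hermitian, so its square is a
scalar, here `1 - |⟨a|b⟩|²`. Thus the hypothesis of `norm_ctrl_le` holds with the sine as `c`. -/
theorem ketBra_sub_conjTranspose_mul_self (a b : ℝ) :
    (ketBra (ket a) - ketBra (ket b))ᴴ * (ketBra (ket a) - ketBra (ket b)) =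
      ((Real.sin ((a - b) / 2) ^ 2 : ℝ) : ℂ) • 1 := by
  have key : (Complex.exp (Complex.I * a) - Complex.exp (Complex.I * b)) *
      (Complex.exp (-(Complex.I * a)) - Complex.exp (-(Complex.I * b))) =
      4 * ((Real.sin ((a - b) / 2) ^ 2 : ℝ) : ℂ) := by
    have e : (Complex.exp (Complex.I * a) - Complex.exp (Complex.I * b)) *
        (Complex.exp (-(Complex.I * a)) - Complex.exp (-(Complex.I * b))) =
        2 - (Complex.exp (((a - b : ℝ) : ℂ) * Complex.I) +
          Complex.exp (-((a - b : ℝ) : ℂ) * Complex.I)) := by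
      have h1 : Complex.exp (((a - b : ℝ) : ℂ) * Complex.I) =
          Complex.exp (Complex.I * a) * Complex.exp (-(Complex.I * b)) := by
        rw [← Complex.exp_add]; congr 1; push_cast; ring
      have h2 : Complex.exp (-((a - b : ℝ) : ℂ) * Complex.I) =
          Complex.exp (Complex.I * b) * Complex.exp (-(Complex.I * a)) := by
        rw [← Complex.exp_add]; congr 1; push_cast; ring
      have h3 : Complex.exp (Complex.I * a) * Complex.exp (-(Complex.I * a)) = 1 := by
        rw [← Complex.exp_add]; simp
      have h4 : Complex.exp (Complex.I * b) * Complex.exp (-(Complex.I * b)) = 1 := by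
        rw [← Complex.exp_add]; simp
      rw [h1, h2]
      linear_combination h3 + h4
    have h5 : Real.sin ((a - b) / 2) ^ 2 = (1 - Real.cos (a - b)) / 2 := by
      rw [Real.sin_sq_eq_half_sub]
      ring_nf
    rw [e, ← Complex.two_cos, h5, ← Complex.ofReal_cos]
    push_cast
    ring
  rw [Matrix.conjTranspose_sub, ketBra_conjTranspose, ketBra_conjTranspose]
  generalize Real.sin ((a - b) / 2) ^ 2 = S at key ⊢
  ext p q
  fin_cases p <;> fin_cases q <;>
    simp [Matrix.mul_apply, Fin.sum_univ_two, ketBra_ket_apply]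
  · linear_combination key / 4
  · linear_combination key / 4

/-! ### Phases of the graph state and the rounded projections -/

variable {n : ℕ}

namespace WeightedGraph

variable (G : WeightedGraph n)

/-- The phase `∑_{j < k} θ_{jk} x_j x_k` of the amplitude of `|G⟩` at `x`. -/
def amplitudePhase (x : Bits n) : ℝ :=
  ∑ e ∈ G.edges, G.θ e.1 e.2 * (((x e.1 : ℕ) : ℝ) * ((x e.2 : ℕ) : ℝ))

/-- The phase `α_k` as a function of all the bits. -/
def bitsPhase (A : Finset (Fin n)) (k : Fin n) (x : Bits n) : ℝ := G.phase A k fun j => x j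

theorem bitsPhase_update {A : Finset (Fin n)} {k k' : Fin n} (hk : k ∈ A) (x : Bits n)
    (b : Fin 2) : G.bitsPhase A k' (Function.update x k b) = G.bitsPhase A k' x := by
  unfold bitsPhase
  congr 1
  funext j
  exact Function.update_of_ne (fun e : (j : Fin n) = k => j.2 (e ▸ hk)) _ _

theorem bitsPhase_eq_sum {A : Finset (Fin n)} (hA : ∀ j ∈ A, ∀ k ∈ A, ¬ G.graph.Adj j k)
    {k : Fin n} (hk : k ∈ A) (x : Bits n) :
    G.bitsPhase A k x = ∑ j, G.θ j k * ((x j : ℕ) : ℝ) := by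
  classical
  rw [bitsPhase, phase, Finset.sum_filter, ← Fintype.sum_subtype_add_sum_subtype (fun j => j ∈ A)]
  have h1 : ∀ s : Finset {j // j ∈ A}, ∑ j ∈ s, G.θ j k * ((x j : ℕ) : ℝ) = 0 := fun s =>
    Finset.sum_eq_zero fun j _ => by rw [G.θ_eq_zero _ _ (hA j j.2 k hk), zero_mul]
  rw [h1, zero_add]
  refine Finset.sum_congr (by ext; simp) fun j _ => ?_
  split_ifs with H
  · rfl
  · rw [G.θ_eq_zero _ _ H, zero_mul]

theorem two_mul_amplitudePhase (x : Bits n) :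
    2 * G.amplitudePhase x =
      ∑ j, ∑ k, G.θ j k * (((x j : ℕ) : ℝ) * ((x k : ℕ) : ℝ)) := by
  classical
  set F : Fin n × Fin n → ℝ := fun e => G.θ e.1 e.2 * (((x e.1 : ℕ) : ℝ) * ((x e.2 : ℕ) : ℝ))
    with hF
  have h1 : G.amplitudePhase x = ∑ e : Fin n × Fin n, if e.1 < e.2 then F e else 0 := by
    rw [amplitudePhase, edges, Finset.sum_filter]
    refine Finset.sum_congr rfl fun e _ => ?_
    by_cases h : e.1 < e.2 <;> by_cases h' : G.graph.Adj e.1 e.2 <;>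
      simp [h, h', hF, G.θ_eq_zero]
  have h2 : G.amplitudePhase x = ∑ e : Fin n × Fin n, if e.2 < e.1 then F e else 0 := by
    rw [h1, ← (Equiv.prodComm (Fin n) (Fin n)).sum_comp]
    refine Finset.sum_congr rfl fun e _ => ?_
    simp only [Equiv.prodComm_apply, Prod.fst_swap, Prod.snd_swap, hF]
    rw [G.θ_symm, mul_comm ((x e.2 : ℕ) : ℝ)]
  rw [two_mul]
  nth_rewrite 1 [h1]
  rw [h2, ← Finset.sum_add_distrib, ← Fintype.sum_prod_type']
  refine Finset.sum_congr rfl fun e _ => ?_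
  change _ = F e
  rcases lt_trichotomy e.1 e.2 with h | h | h
  · simp [h, h.le.not_gt]
  · have : F e = 0 := by simp [hF, h, G.θ_eq_zero _ _ (G.graph.loopless.irrefl e.2)]
    simp [this]
  · simp [h, h.le.not_gt]

/-- The phase is a quadratic form with zero diagonal, hence affine in bit `k`. Its slope is the sum
of the weights to the set bits, and by independence these weights vanish inside `A`. -/
theorem amplitudePhase_sub {A : Finset (Fin n)} (hA : ∀ j ∈ A, ∀ k ∈ A, ¬ G.graph.Adj j k)
    {k : Fin n} (hk : k ∈ A) {x y : Bits n} (hxy : ∀ j, j ≠ k → x j = y j) :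
    G.amplitudePhase x - G.amplitudePhase y =
      G.bitsPhase A k x * (((x k : ℕ) : ℝ) - ((y k : ℕ) : ℝ)) := by
  set d : ℝ := ((x k : ℕ) : ℝ) - ((y k : ℕ) : ℝ) with hd
  have hx : ∀ j, ((y j : ℕ) : ℝ) = ((x j : ℕ) : ℝ) - if j = k then d else 0 := by
    intro j
    split_ifs with h
    · subst h; simp [hd]
    · simp [hxy j h]
  have hkk : G.θ k k = 0 := G.θ_eq_zero _ _ (G.graph.loopless.irrefl k)
  have e1 := G.two_mul_amplitudePhase x
  have e2 := G.two_mul_amplitudePhase y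
  have e3 := G.bitsPhase_eq_sum hA hk x
  simp only [hx] at e2
  have e4 : ∑ j, ∑ l, G.θ j l * ((((x j : ℕ) : ℝ) - if j = k then d else 0) *
      (((x l : ℕ) : ℝ) - if l = k then d else 0)) =
      ∑ j, ∑ l, G.θ j l * (((x j : ℕ) : ℝ) * ((x l : ℕ) : ℝ)) -
        2 * d * ∑ j, G.θ j k * ((x j : ℕ) : ℝ) := by
    have e5 : ∑ l, G.θ k l * ((x l : ℕ) : ℝ) = ∑ j, G.θ j k * ((x j : ℕ) : ℝ) :=
      Finset.sum_congr rfl fun j _ => by rw [G.θ_symm]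
    simp only [mul_sub, sub_mul, Finset.sum_sub_distrib, mul_ite, ite_mul, mul_zero, zero_mul,
      Finset.sum_ite_eq', Finset.mem_univ, if_true, hkk, Finset.sum_ite_irrel,
      Finset.sum_const_zero]
    have e6 : ∑ j, G.θ j k * (((x j : ℕ) : ℝ) * d) = d * ∑ j, G.θ j k * ((x j : ℕ) : ℝ) := by
      rw [Finset.mul_sum]; exact Finset.sum_congr rfl fun _ _ => by ring
    have e7 : ∑ l, G.θ k l * (d * ((x l : ℕ) : ℝ)) = d * ∑ j, G.θ j k * ((x j : ℕ) : ℝ) := by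
      rw [← e5, Finset.mul_sum]; exact Finset.sum_congr rfl fun _ _ => by ring
    rw [e6, e7]
    ring
  rw [e4, ← e1, ← e3] at e2
  linarith

theorem gate_eq_diagonal (j k : Fin n) (t : ℝ) :
    gate j k t = diagonal fun x : Bits n =>
      Complex.exp (Complex.I * ((t * (((x j : ℕ) : ℝ) * ((x k : ℕ) : ℝ)) : ℝ) : ℂ)) := by
  have h0 := onQubit_bitProj j 1 0
  have h1 := onQubit_bitProj j 0 1
  have h2 := onQubit_bitProj k 1 (Complex.exp (Complex.I * t))
  simp only [one_smul, zero_smul, add_zero, zero_add] at h0 h1 h2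
  rw [gate, h0, h1, h2, Matrix.diagonal_mul_diagonal, Matrix.diagonal_add]
  congr 1
  funext x
  generalize x j = p
  generalize x k = q
  fin_cases p <;> fin_cases q <;> simp

/-- The diagonal unitary which prepares `|G⟩` from `|+⟩^{⊗ n}`. -/
def prep : Op n := diagonal fun x => Complex.exp (Complex.I * (G.amplitudePhase x : ℂ))

theorem state_eq : G.state = G.prep.mulVec (plusState n) := by
  classical
  have : ∀ (s : Finset (Fin n × Fin n)) (comm), s.noncommProd
      (fun e => gate (n := n) e.1 e.2 (G.θ e.1 e.2)) comm = diagonal fun x : Bits n =>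
        Complex.exp (Complex.I * ((∑ e ∈ s,
          G.θ e.1 e.2 * (((x e.1 : ℕ) : ℝ) * ((x e.2 : ℕ) : ℝ)) : ℝ) : ℂ)) := by
    intro s
    induction s using Finset.induction_on with
    | empty => intro; simp
    | insert a s ha ih =>
      intro comm
      rw [Finset.noncommProd_insert_of_notMem _ _ _ _ ha, ih, gate_eq_diagonal,
        diagonal_mul_diagonal]
      congr 1
      funext x
      rw [Finset.sum_insert ha, ← Complex.exp_add]
      push_cast
      ring_nf
  exact congrArg (fun U : Op n => U.mulVec (plusState n)) (this _ _)

theorem prep_mul_conjTranspose : G.prep * G.prepᴴ = 1 := by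
  rw [prep, diagonal_conjTranspose, diagonal_mul_diagonal, ← diagonal_one]
  congr 1
  funext x
  simp only [Pi.star_apply, RCLike.star_def]
  rw [← Complex.exp_conj, ← Complex.exp_add]
  simp

/-- Conjugating by a diagonal unitary multiplies an entry by the phase difference of its two
strings, which `amplitudePhase_sub` identifies with the phase of an entry of `|α_k⟩⟨α_k|`. -/
theorem prep_conj_ctrl {A : Finset (Fin n)} (hA : ∀ j ∈ A, ∀ k ∈ A, ¬ G.graph.Adj j k)
    {k : Fin n} (hk : k ∈ A) :
    G.prep * ctrl k (fun _ => ketBra (ket 0)) * G.prepᴴ =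
      ctrl k fun x => ketBra (ket (G.bitsPhase A k x)) := by
  ext x y
  rw [prep, diagonal_conjTranspose, mul_diagonal, diagonal_mul]
  simp only [ctrl]
  split_ifs with H
  · simp only [ketBra_ket_apply, ← G.amplitudePhase_sub hA hk H, Pi.star_apply, RCLike.star_def]
    rw [← Complex.exp_conj]
    simp only [map_mul, Complex.conj_I, Complex.conj_ofReal, zero_mul, Complex.ofReal_zero,
      mul_zero, Complex.exp_zero]
    rw [mul_one_div, div_mul_eq_mul_div, ← Complex.exp_add]
    congr 2
    push_cast
    ring
  · simp

theorem Q_eq_ctrl (h : ℕ) {A : Finset (Fin n)} {k : Fin n} (hk : k ∈ A) :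
    G.Q h A k = ctrl k fun x => ketBra (ket (roundPhase h (G.bitsPhase A k x))) := by
  ext x y
  have hz : ∀ z : Outcome A, (∀ j : {j : Fin n // j ∉ A}, y j = z j) ↔ (fun j : {j : Fin n // j ∉ A} => y j) = z :=
    fun z => funext_iff.symm
  simp only [Q, Matrix.sum_apply, outcomeProj, mul_diagonal, hz, mul_ite, mul_one, mul_zero,
    Finset.sum_ite_eq, Finset.mem_univ, if_true]
  simp only [onQubit, ctrl]
  split_ifs with H
  · have : G.bitsPhase A k y = G.bitsPhase A k x := by
      rw [(agree_iff_exists_update k x y).mp H, G.bitsPhase_update hk]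
    rw [← this]
    rfl
  · rfl

end WeightedGraph

/-! ### The rounding error -/

theorem abs_roundPhase_sub_le {h : ℕ} (hh : 0 < h) (α : ℝ) :
    |roundPhase h α - α| ≤ Real.pi / (2 * h) := by
  have hpi := Real.pi_pos
  have hh' : (0 : ℝ) < h := Nat.cast_pos.mpr hh
  set r : ℤ := ⌊α * h / Real.pi + 1 / 2⌋ with hr
  have h1 : (r : ℝ) ≤ α * h / Real.pi + 1 / 2 := Int.floor_le _
  have h2 : α * h / Real.pi + 1 / 2 < r + 1 := Int.lt_floor_add_one _
  have e : roundPhase h α - α = (r - α * h / Real.pi) * (Real.pi / h) := by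
    rw [roundPhase, ← hr]
    field_simp
  have e' : Real.pi / (2 * h) = 1 / 2 * (Real.pi / h) := by field_simp
  rw [e, e', abs_mul, abs_of_pos (div_pos hpi hh')]
  refine mul_le_mul_of_nonneg_right ?_ (div_pos hpi hh').le
  rw [abs_le]
  constructor <;> linarith

theorem abs_sin_half_le {h : ℕ} (hh : 0 < h) {δ : ℝ} (hδ : |δ| ≤ Real.pi / (2 * h)) :
    |Real.sin (δ / 2)| ≤ Real.sin (Real.pi / (4 * h)) := by
  have hpi := Real.pi_pos
  have hh' : (1 : ℝ) ≤ h := Nat.one_le_cast.mpr hh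
  have e : Real.pi / (4 * h) = Real.pi / (2 * h) / 2 := by field_simp; norm_num
  have h1 : Real.pi / (4 * h) ≤ Real.pi / 2 := by
    apply div_le_div_of_nonneg_left hpi.le (by norm_num) (by linarith)
  obtain ⟨h2, h3⟩ := abs_le.mp hδ
  rw [abs_le, ← Real.sin_neg]
  constructor <;> apply Real.sin_le_sin_of_le_of_le_pi_div_two <;> linarith

/-! ### The graph basis and the unrounded test operators -/

/-- The normalized Hadamard matrix. -/
def hadamard : Matrix (Fin 2) (Fin 2) ℂ := fun p q => ket (Real.pi * ((q : ℕ) : ℝ)) p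

theorem hadamard_mul_conjTranspose : hadamard * hadamardᴴ = 1 := by
  have h2 : (Real.sqrt 2 : ℂ)⁻¹ * (Real.sqrt 2 : ℂ)⁻¹ = 2⁻¹ := by
    rw [← mul_inv, ← Complex.ofReal_mul, Real.mul_self_sqrt (by norm_num)]; norm_num
  have h3 : Complex.exp (Complex.I * Real.pi) = -1 := by rw [mul_comm, Complex.exp_pi_mul_I]
  ext p q
  fin_cases p <;> fin_cases q <;>
    simp [Matrix.mul_apply, Fin.sum_univ_two, hadamard, ket, h3, div_eq_mul_inv] <;>
    rw [h2] <;> norm_num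

theorem hadamard_conj_bitProj :
    hadamard * diagonal (fun b : Fin 2 => if b = 0 then 1 else 0) * hadamardᴴ = ketBra (ket 0) := by
  ext p q
  simp [Matrix.mul_apply, Fin.sum_univ_two, hadamard, ketBra, Matrix.vecMulVec_apply]

theorem ketBra_mulVec {ι : Type} [Fintype ι] (U : Matrix ι ι ℂ) (v : ι → ℂ) :
    ketBra (U.mulVec v) = U * ketBra v * Uᴴ := by
  rw [ketBra, ketBra, Matrix.mul_vecMulVec, Matrix.vecMulVec_mul, Matrix.star_mulVec]

theorem ketBra_prod {ι D : Type} [Fintype ι] (ψ : ι → D → ℂ) :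
    ketBra (fun x : ι → D => ∏ j, ψ j (x j)) = tensorProd fun j => ketBra (ψ j) := by
  ext x y
  simp [ketBra, tensorProd, Matrix.vecMulVec_apply, Finset.prod_mul_distrib]

theorem tensorProd_ite_eq_ctrl (k : Fin n) (M : Matrix (Fin 2) (Fin 2) ℂ) :
    tensorProd (fun j => if j = k then M else 1) = ctrl k fun _ => M := by
  ext x y
  rw [tensorProd, ← Finset.mul_prod_erase _ _ (Finset.mem_univ k), if_pos rfl, ctrl]
  split_ifs with H
  · rw [Finset.prod_eq_one, mul_one]
    intro j hj
    have := Finset.ne_of_mem_erase hj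
    rw [if_neg this, H j this, Matrix.one_apply_eq]
  · push Not at H
    obtain ⟨j, hj, hxy⟩ := H
    rw [Finset.prod_eq_zero (Finset.mem_erase.mpr ⟨hj, Finset.mem_univ j⟩), mul_zero]
    simp [hj, hxy]

namespace WeightedGraph

variable (G : WeightedGraph n)

/-- The unitary which maps the computational basis to the graph basis of `G`. -/
def graphBasis : Op n := G.prep * tensorProd fun _ : Fin n => hadamard

theorem graphBasis_mul_conjTranspose : G.graphBasis * G.graphBasisᴴ = 1 := by
  have : G.graphBasis * G.graphBasisᴴ = G.prep *
      (tensorProd (fun _ : Fin n => hadamard) * tensorProd fun _ : Fin n => hadamardᴴ) *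
        G.prepᴴ := by
    rw [graphBasis, Matrix.conjTranspose_mul, tensorProd_conjTranspose]
    simp only [Matrix.mul_assoc]
  rw [this, tensorProd_mul, hadamard_mul_conjTranspose, tensorProd_one, Matrix.mul_one,
    prep_mul_conjTranspose]

theorem graphBasis_conj_tensorProd (M : Fin n → Matrix (Fin 2) (Fin 2) ℂ) :
    G.graphBasis * tensorProd M * G.graphBasisᴴ =
      G.prep * tensorProd (fun j => hadamard * M j * hadamardᴴ) * G.prepᴴ := by
  have : G.graphBasis * tensorProd M * G.graphBasisᴴ = G.prep *
      (tensorProd (fun _ : Fin n => hadamard) * tensorProd M *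
        tensorProd fun _ : Fin n => hadamardᴴ) * G.prepᴴ := by
    rw [graphBasis, Matrix.conjTranspose_mul, tensorProd_conjTranspose]
    simp only [Matrix.mul_assoc]
  rw [this, tensorProd_mul, tensorProd_mul]

theorem ketBra_state : ketBra G.state =
    G.graphBasis * diagonal (fun y => ∏ k, if y k = 0 then 1 else 0) * G.graphBasisᴴ := by
  rw [← tensorProd_diagonal (fun (_ : Fin n) (b : Fin 2) => if b = 0 then (1 : ℂ) else 0),
    graphBasis_conj_tensorProd, hadamard_conj_bitProj, state_eq, ketBra_mulVec]
  rw [show plusState n = fun x => ∏ j, ket 0 (x j) from rfl, ketBra_prod (fun _ => ket 0)]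

/-- The Hadamard matrix turns `|0⟩⟨0|` on qubit `k` into `|+⟩⟨+|`, and the preparation unitary turns
that into the unrounded projection. The unrounded projections are therefore diagonal in one basis
that does not depend on `A`. -/
theorem graphBasis_conj_bit {A : Finset (Fin n)} (hA : ∀ j ∈ A, ∀ k ∈ A, ¬ G.graph.Adj j k)
    {k : Fin n} (hk : k ∈ A) :
    G.graphBasis * diagonal (fun y : Bits n => if y k = 0 then 1 else 0) * G.graphBasisᴴ =
      ctrl k fun x => ketBra (ket (G.bitsPhase A k x)) := by
  have e : diagonal (fun y : Bits n => if y k = 0 then (1 : ℂ) else 0) =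
      tensorProd fun j => if j = k then
        diagonal (fun b : Fin 2 => if b = 0 then (1 : ℂ) else 0) else 1 := by
    have := tensorProd_diagonal
      (fun (j : Fin n) (b : Fin 2) => if j = k then if b = 0 then (1 : ℂ) else 0 else 1)
    simp only [Finset.prod_ite_eq', Finset.mem_univ, if_true] at this
    rw [← this]
    congr 1
    funext j
    split_ifs <;> simp
  rw [e, graphBasis_conj_tensorProd, ← G.prep_conj_ctrl hA hk, ← tensorProd_ite_eq_ctrl]
  congr 3
  funext j
  split_ifs
  · exact hadamard_conj_bitProj
  · rw [Matrix.mul_one, hadamard_mul_conjTranspose]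

/-- The eigenvalue of the unrounded factor at the element `y` of the graph basis. -/
def eigenvalue (h : ℕ) (k : Fin n) (y : Bits n) : ℝ := if y k = 0 then 1 else ((h : ℝ) - 1) / h

theorem eigenvalue_nonneg {h : ℕ} (hh : 0 < h) (k : Fin n) (y : Bits n) : 0 ≤ eigenvalue h k y := by
  have : (1 : ℝ) ≤ h := Nat.one_le_cast.mpr hh
  unfold eigenvalue
  split_ifs
  · exact zero_le_one
  · exact div_nonneg (by linarith) (by linarith)

theorem eigenvalue_le_one {h : ℕ} (hh : 0 < h) (k : Fin n) (y : Bits n) : eigenvalue h k y ≤ 1 := by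
  have : (1 : ℝ) ≤ h := Nat.one_le_cast.mpr hh
  unfold eigenvalue
  split_ifs
  · exact le_rfl
  · rw [div_le_one (by linarith)]; linarith

/-- The factor without rounding of the phase. -/
def exactFactor (h : ℕ) (k : Fin n) : Op n :=
  G.graphBasis * diagonal (fun y => (eigenvalue h k y : ℂ)) * G.graphBasisᴴ

theorem norm_conj_graphBasis (M : Op n) : ‖G.graphBasis * M * G.graphBasisᴴ‖ = ‖M‖ := by
  have hU : G.graphBasis ∈ unitary (Op n) :=
    mem_unitaryGroup_iff.mpr G.graphBasis_mul_conjTranspose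
  rw [← star_eq_conjTranspose, CStarRing.norm_mul_mem_unitary _ (Unitary.star_mem hU),
    CStarRing.norm_mem_unitary_mul _ hU]

theorem norm_exactFactor_le {h : ℕ} (hh : 0 < h) (k : Fin n) : ‖G.exactFactor h k‖ ≤ 1 := by
  rw [exactFactor, norm_conj_graphBasis, l2_opNorm_diagonal]
  refine (pi_norm_le_iff_of_nonneg zero_le_one).mpr fun y => ?_
  rw [Complex.norm_real, Real.norm_eq_abs, abs_of_nonneg (eigenvalue_nonneg hh k y)]
  exact eigenvalue_le_one hh k y

theorem exactFactor_eq {h : ℕ} (hh : 0 < h) {A : Finset (Fin n)}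
    (hA : ∀ j ∈ A, ∀ k ∈ A, ¬ G.graph.Adj j k) {k : Fin n} (hk : k ∈ A) :
    G.exactFactor h k = (1 / (h : ℂ)) • ctrl k (fun x => ketBra (ket (G.bitsPhase A k x))) +
      (((h : ℂ) - 1) / (h : ℂ)) • (1 : Op n) := by
  have hh' : (h : ℂ) ≠ 0 := Nat.cast_ne_zero.mpr hh.ne'
  have e : diagonal (fun y : Bits n => (eigenvalue h k y : ℂ)) =
      (1 / (h : ℂ)) • diagonal (fun y : Bits n => if y k = 0 then 1 else 0) +
        (((h : ℂ) - 1) / (h : ℂ)) • (1 : Op n) := by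
    rw [← diagonal_one, ← diagonal_smul, ← diagonal_smul, diagonal_add]
    congr 1
    funext y
    simp only [eigenvalue, Pi.smul_apply, smul_eq_mul]
    split_ifs
    · push_cast; field_simp; ring
    · push_cast; field_simp; ring
  rw [exactFactor, e, ← G.graphBasis_conj_bit hA hk, Matrix.mul_add, Matrix.add_mul,
    Matrix.mul_smul, Matrix.smul_mul, Matrix.mul_smul, Matrix.smul_mul, Matrix.mul_one,
    graphBasis_mul_conjTranspose]

theorem isStarProjection_Q (h : ℕ) {A : Finset (Fin n)} {k : Fin n} (hk : k ∈ A) :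
    IsStarProjection (G.Q h A k) := by
  have inv : ∀ (x : Bits n) (b : Fin 2),
      ketBra (ket (roundPhase h (G.bitsPhase A k (Function.update x k b)))) =
        ketBra (ket (roundPhase h (G.bitsPhase A k x))) := fun x b => by
    rw [G.bitsPhase_update hk]
  rw [Q_eq_ctrl _ _ hk]
  constructor
  · rw [IsIdempotentElem, ctrl_mul inv]
    simp only [ketBra_mul_self (star_ket_dotProduct_ket _)]
  · rw [IsSelfAdjoint, star_eq_conjTranspose, ctrl_conjTranspose inv]
    simp only [ketBra_conjTranspose]

theorem one_sub_factor_eq {h : ℕ} (hh : 0 < h) (A : Finset (Fin n)) (k : Fin n) :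
    1 - G.factor h A k = (1 / (h : ℂ)) • (1 - G.Q h A k) := by
  have hh' : (h : ℂ) ≠ 0 := Nat.cast_ne_zero.mpr hh.ne'
  have : (((h : ℂ) - 1) / (h : ℂ)) = 1 - 1 / (h : ℂ) := by field_simp
  rw [factor, this]
  module

theorem factor_nonneg {h : ℕ} (hh : 0 < h) {A : Finset (Fin n)} {k : Fin n} (hk : k ∈ A) :
    0 ≤ G.factor h A k := by
  have hQ := nonneg_iff_posSemidef.mp (G.isStarProjection_Q h hk).nonneg
  have hh' : (1 : ℝ) ≤ h := Nat.one_le_cast.mpr hh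
  refine nonneg_iff_posSemidef.mpr ((hQ.smul ?_).add (PosSemidef.one.smul ?_))
  · have : (1 / (h : ℂ)) = ((1 / (h : ℝ) : ℝ) : ℂ) := by push_cast; rfl
    rw [this, Complex.zero_le_real]
    positivity
  · have : (((h : ℂ) - 1) / (h : ℂ)) = ((((h : ℝ) - 1) / (h : ℝ) : ℝ) : ℂ) := by push_cast; rfl
    rw [this, Complex.zero_le_real]
    exact div_nonneg (by linarith) (by linarith)

theorem norm_factor_le {h : ℕ} (hh : 0 < h) {A : Finset (Fin n)} {k : Fin n} (hk : k ∈ A) :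
    ‖G.factor h A k‖ ≤ 1 := by
  rw [CStarAlgebra.norm_le_one_iff_of_nonneg _ (G.factor_nonneg hh hk), ← sub_nonneg,
    G.one_sub_factor_eq hh]
  have hQ := nonneg_iff_posSemidef.mp (G.isStarProjection_Q h hk).one_sub.nonneg
  refine nonneg_iff_posSemidef.mpr (hQ.smul ?_)
  have : (1 / (h : ℂ)) = ((1 / (h : ℝ) : ℝ) : ℂ) := by push_cast; rfl
  rw [this, Complex.zero_le_real]
  positivity

/-- The identity parts cancel, leaving `1 / h` times a controlled difference of two pure projections
whose angles differ by at most `π / (2h)`. -/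
theorem norm_factor_sub_exactFactor_le {h : ℕ} (hh : 0 < h) {A : Finset (Fin n)}
    (hA : ∀ j ∈ A, ∀ k ∈ A, ¬ G.graph.Adj j k) {k : Fin n} (hk : k ∈ A) :
    ‖G.factor h A k - G.exactFactor h k‖ ≤ Real.sin (Real.pi / (4 * h)) / h := by
  have hh' : (0 : ℝ) < h := Nat.cast_pos.mpr hh
  have hb := fun x => abs_sin_half_le hh (abs_roundPhase_sub_le hh (G.bitsPhase A k x))
  have hs : 0 ≤ Real.sin (Real.pi / (4 * h)) := (abs_nonneg _).trans (hb 0)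
  rw [factor, exactFactor_eq G hh hA hk, add_sub_add_right_eq_sub, ← smul_sub,
    Q_eq_ctrl _ _ hk, ctrl_sub, norm_smul, norm_div, norm_one, Complex.norm_natCast, div_mul_eq_mul_div,
    one_mul]
  refine div_le_div_of_nonneg_right ?_ hh'.le
  exact norm_ctrl_le (fun x b => by simp only [G.bitsPhase_update hk]) hs _ hb
    (fun x => ketBra_sub_conjTranspose_mul_self _ _)

theorem Pbar_nonneg {h : ℕ} (hh : 0 < h) (A : Finset (Fin n)) : 0 ≤ G.Pbar h A :=
  noncommProd_nonneg _ _ (fun _ hk => G.factor_nonneg hh hk) _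

theorem Pbar_le_one {h : ℕ} (hh : 0 < h) (A : Finset (Fin n)) : G.Pbar h A ≤ 1 := by
  rw [← CStarAlgebra.norm_le_one_iff_of_nonneg _ (G.Pbar_nonneg hh A)]
  exact norm_noncommProd_le_one _ _ (fun _ hk => G.norm_factor_le hh hk) _

/-- The operator `P̄` without rounding of the phases. -/
def exactPbar (h : ℕ) (A : Finset (Fin n)) : Op n :=
  G.graphBasis * diagonal (fun y => ((∏ k ∈ A, eigenvalue h k y : ℝ) : ℂ)) * G.graphBasisᴴ

theorem exactPbar_eq (h : ℕ) (A : Finset (Fin n)) :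
    G.exactPbar h A = A.noncommProd (G.exactFactor h) (fun _ _ _ _ _ =>
      commute_conj_diagonal G.graphBasis_mul_conjTranspose _ _) := by
  have := noncommProd_conj_diagonal G.graphBasis_mul_conjTranspose
    (fun k y => (eigenvalue h k y : ℂ)) A (fun _ _ _ _ _ =>
      commute_conj_diagonal G.graphBasis_mul_conjTranspose _ _)
  refine Eq.trans ?_ this.symm
  simp only [exactPbar, Complex.ofReal_prod]

/-- The telescoping estimate bounds the norm of the difference, and a self-adjoint element lies
below its norm. -/
theorem Pbar_sub_exactPbar_le {h : ℕ} (hh : 0 < h) {A : Finset (Fin n)}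
    (hA : ∀ j ∈ A, ∀ k ∈ A, ¬ G.graph.Adj j k) :
    (((A.card * (Real.sin (Real.pi / (4 * h)) / h) : ℝ) : ℂ) • (1 : Op n) -
      (G.Pbar h A - G.exactPbar h A)).PosSemidef := by
  set r : ℝ := A.card * (Real.sin (Real.pi / (4 * h)) / h) with hr
  set X := G.Pbar h A - G.exactPbar h A with hX
  have hn : ‖X‖ ≤ r := by
    rw [hX, exactPbar_eq]
    refine (norm_noncommProd_sub_le A (G.factor h A) (G.exactFactor h)
      (fun _ hk => G.norm_factor_le hh hk) (fun k _ => G.norm_exactFactor_le hh k)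
      (G.factor_commute h A) _).trans ?_
    refine (Finset.sum_le_card_nsmul _ _ _ fun k hk =>
      G.norm_factor_sub_exactFactor_le hh hA hk).trans ?_
    rw [nsmul_eq_mul]
  have hsa : IsSelfAdjoint X := by
    refine (IsSelfAdjoint.of_nonneg (G.Pbar_nonneg hh A)).sub ?_
    rw [IsSelfAdjoint, star_eq_conjTranspose, exactPbar, Matrix.conjTranspose_mul,
      Matrix.conjTranspose_mul, Matrix.conjTranspose_conjTranspose, diagonal_conjTranspose,
      Matrix.mul_assoc]
    congr 3
    funext y
    simp
  have h1 : (algebraMap ℝ (Op n) ‖X‖ - X).PosSemidef := hsa.le_algebraMap_norm_self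
  have h2 : (((r - ‖X‖ : ℝ) : ℂ) • (1 : Op n)).PosSemidef :=
    PosSemidef.one.smul (Complex.zero_le_real.mpr (sub_nonneg.mpr hn))
  have e : algebraMap ℝ (Op n) ‖X‖ = (‖X‖ : ℂ) • (1 : Op n) := by
    rw [Algebra.algebraMap_eq_smul_one]
    ext i j
    simp
  have := h1.add h2
  rw [e] at this
  convert this using 1
  push_cast
  module

end WeightedGraph

/-! ### The operator inequality between infidelity and rejection -/

section Cover

variable {m : ℕ} {G : WeightedGraph n} (𝒜 : IndependenceCover G m)

theorem omegaBar_posSemidef {h : ℕ} (hh : 0 < h) : (omegaBar 𝒜 h).PosSemidef := by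
  refine posSemidef_sum _ fun l _ => (nonneg_iff_posSemidef.mp (G.Pbar_nonneg hh _)).smul ?_
  have : (1 / (m : ℂ)) = ((1 / (m : ℝ) : ℝ) : ℂ) := by push_cast; rfl
  rw [this, Complex.zero_le_real]
  positivity

theorem one_sub_omegaBar_eq (hm : 0 < m) (h : ℕ) :
    1 - omegaBar 𝒜 h = ∑ l, (1 / (m : ℂ)) • (1 - G.Pbar h (𝒜.A l)) := by
  have hm' : (m : ℂ) ≠ 0 := Nat.cast_ne_zero.mpr hm.ne'
  simp only [omegaBar, smul_sub, Finset.sum_sub_distrib]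
  congr 1
  rw [Finset.sum_const, Finset.card_univ, Fintype.card_fin, ← Nat.cast_smul_eq_nsmul ℂ, smul_smul,
    mul_one_div_cancel hm', one_smul]

theorem one_sub_omegaBar_posSemidef (hm : 0 < m) {h : ℕ} (hh : 0 < h) :
    (1 - omegaBar 𝒜 h).PosSemidef := by
  rw [one_sub_omegaBar_eq 𝒜 hm]
  refine posSemidef_sum _ fun l _ => PosSemidef.smul (G.Pbar_le_one hh _) ?_
  have : (1 / (m : ℂ)) = ((1 / (m : ℝ) : ℝ) : ℂ) := by push_cast; rfl
  rw [this, Complex.zero_le_real]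
  positivity

theorem sum_card_le (hdisj : ∀ l l', l ≠ l' → Disjoint (𝒜.A l) (𝒜.A l')) :
    ∑ l, (𝒜.A l).card ≤ n := by
  rw [← Finset.card_biUnion fun l _ l' _ hne => hdisj l l' hne]
  exact (Finset.card_le_univ _).trans_eq (Fintype.card_fin n)

theorem sum_one_sub_exactPbar {h : ℕ} (hh : 0 < h) :
    (∑ l, (h : ℂ) • (1 - G.exactPbar h (𝒜.A l)) - (1 - ketBra G.state)).PosSemidef := by
  -- The eigenvalue of the whole operator at the graph-basis label `y`.
  set f : Bits n → ℝ := fun y => ∑ l, (h : ℝ) * (1 - ∏ k ∈ 𝒜.A l, WeightedGraph.eigenvalue h k y) -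
    (1 - ∏ k, if y k = 0 then (1 : ℝ) else 0) with hf
  have e : ∑ l, (h : ℂ) • (1 - G.exactPbar h (𝒜.A l)) - (1 - ketBra G.state) =
      G.graphBasis * diagonal (fun y => (f y : ℂ)) * G.graphBasisᴴ := by
    have e1 : diagonal (fun y => (f y : ℂ)) = ∑ l, (h : ℂ) • (1 - diagonal fun y : Bits n =>
        ((∏ k ∈ 𝒜.A l, WeightedGraph.eigenvalue h k y : ℝ) : ℂ)) -
          (1 - diagonal fun y => ∏ k, if y k = 0 then 1 else 0) := by
      ext x y
      rcases eq_or_ne x y with rfl | hxy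
      · simp [Matrix.sum_apply, hf, apply_ite Complex.ofReal]
      · simp [Matrix.sum_apply, hxy]
    rw [e1]
    simp only [G.ketBra_state, WeightedGraph.exactPbar, Matrix.mul_sub, Matrix.sub_mul,
      Matrix.mul_sum, Matrix.sum_mul, Matrix.mul_smul, Matrix.smul_mul, Matrix.mul_one,
      G.graphBasis_mul_conjTranspose]
  rw [e]
  refine PosSemidef.mul_mul_conjTranspose_same (posSemidef_diagonal_iff.mpr fun y => ?_) _
  rw [Complex.zero_le_real]
  have hh' : (0 : ℝ) < h := Nat.cast_pos.mpr hh
  have hle : ∀ s : Finset (Fin n), ∏ k ∈ s, WeightedGraph.eigenvalue h k y ≤ 1 := fun s =>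
    Finset.prod_le_one (fun k _ => WeightedGraph.eigenvalue_nonneg hh k y)
      fun k _ => WeightedGraph.eigenvalue_le_one hh k y
  have hterm : ∀ l ∈ Finset.univ, 0 ≤
      (h : ℝ) * (1 - ∏ k ∈ 𝒜.A l, WeightedGraph.eigenvalue h k y) := fun l _ =>
    mul_nonneg hh'.le (sub_nonneg.mpr (hle _))
  -- At label `0` everything vanishes. Otherwise one set containing a nonzero bit already
  -- contributes at least `h * (1 / h) = 1`, which pays for the infidelity `1`.
  by_cases hy : ∀ k, y k = 0
  · simp [hf, hy, WeightedGraph.eigenvalue]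
  · push Not at hy
    obtain ⟨k, hk⟩ := hy
    obtain ⟨l, hl⟩ := 𝒜.cover k
    have h2 : ∏ k, (if y k = 0 then (1 : ℝ) else 0) = 0 :=
      Finset.prod_eq_zero (Finset.mem_univ k) (by simp [hk])
    have h3 : ∏ k ∈ 𝒜.A l, WeightedGraph.eigenvalue h k y ≤ ((h : ℝ) - 1) / h := by
      rw [← Finset.mul_prod_erase _ _ hl]
      have : WeightedGraph.eigenvalue h k y = ((h : ℝ) - 1) / h := by
        simp [WeightedGraph.eigenvalue, hk]
      rw [← this]
      exact mul_le_of_le_one_right (WeightedGraph.eigenvalue_nonneg hh k y) (hle _)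
    have h4 : 1 ≤ (h : ℝ) * (1 - ∏ k ∈ 𝒜.A l, WeightedGraph.eigenvalue h k y) := by
      rw [le_div_iff₀ hh'] at h3
      linarith
    have h5 := Finset.single_le_sum hterm (Finset.mem_univ l)
    simp only [hf, h2]
    linarith

/-- The infidelity with `|G⟩` is controlled by the failure of the test. -/
theorem infidelity_le (hm : 0 < m) (hdisj : ∀ l l', l ≠ l' → Disjoint (𝒜.A l) (𝒜.A l'))
    {h : ℕ} (hh : 0 < h) :
    (((m * h : ℝ) : ℂ) • (1 - omegaBar 𝒜 h) +
      ((n * Real.sin (Real.pi / (4 * h)) : ℝ) : ℂ) • (1 : Op n) -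
        (1 - ketBra G.state)).PosSemidef := by
  have hm' : (m : ℂ) ≠ 0 := Nat.cast_ne_zero.mpr hm.ne'
  have hh' : (h : ℝ) ≠ 0 := Nat.cast_ne_zero.mpr hh.ne'
  set s := Real.sin (Real.pi / (4 * h)) with hs
  have hs0 : 0 ≤ s := (abs_nonneg _).trans (abs_sin_half_le hh (abs_roundPhase_sub_le hh 0))
  have h1 : (∑ l, ((h : ℝ) : ℂ) • ((((𝒜.A l).card * (s / h) : ℝ) : ℂ) • (1 : Op n) -
      (G.Pbar h (𝒜.A l) - G.exactPbar h (𝒜.A l)))).PosSemidef :=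
    posSemidef_sum _ fun l _ => (G.Pbar_sub_exactPbar_le hh (𝒜.indep l)).smul
      (Complex.zero_le_real.mpr (Nat.cast_nonneg h))
  have hcard : (((∑ l, (𝒜.A l).card : ℕ) : ℝ)) ≤ n := Nat.cast_le.mpr (sum_card_le 𝒜 hdisj)
  have h2 : (((n * s - ((∑ l, (𝒜.A l).card : ℕ) : ℝ) * s : ℝ) : ℂ) • (1 : Op n)).PosSemidef :=
    PosSemidef.one.smul (Complex.zero_le_real.mpr
      (sub_nonneg.mpr (mul_le_mul_of_nonneg_right hcard hs0)))
  have e1 : ((m * h : ℝ) : ℂ) • (1 - omegaBar 𝒜 h) =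
      ∑ l, (h : ℂ) • (1 - G.Pbar h (𝒜.A l)) := by
    rw [one_sub_omegaBar_eq 𝒜 hm, Finset.smul_sum]
    refine Finset.sum_congr rfl fun l _ => ?_
    rw [smul_smul]
    congr 1
    push_cast
    field_simp
  have e2 : ∀ l, ((h : ℝ) : ℂ) • ((((𝒜.A l).card * (s / h) : ℝ) : ℂ) • (1 : Op n) -
      (G.Pbar h (𝒜.A l) - G.exactPbar h (𝒜.A l))) =
      (h : ℂ) • (1 - G.Pbar h (𝒜.A l)) - (h : ℂ) • (1 - G.exactPbar h (𝒜.A l)) +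
        (((((𝒜.A l).card : ℝ) * s : ℝ)) : ℂ) • (1 : Op n) := by
    intro l
    have : (((𝒜.A l).card : ℝ) * s) = (h : ℝ) * ((𝒜.A l).card * (s / h)) := by field_simp
    rw [this]
    push_cast
    module
  have e3 : ∑ l, (((((𝒜.A l).card : ℝ) * s : ℝ)) : ℂ) • (1 : Op n) =
      ((((∑ l, (𝒜.A l).card : ℕ) : ℝ) * s : ℝ) : ℂ) • (1 : Op n) := by
    rw [← Finset.sum_smul, ← Complex.ofReal_sum, ← Finset.sum_mul, Nat.cast_sum]
  -- The unrounded operators cancel between the first two terms; the third raises the total error `∑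
  -- |A_l| s` to `n s`.
  have h3 := (h1.add (sum_one_sub_exactPbar 𝒜 hh)).add h2
  simp only [e2, Finset.sum_add_distrib, Finset.sum_sub_distrib] at h3
  rw [e3] at h3
  rw [e1]
  convert h3 using 1
  push_cast
  module

end Cover

/-! ### The probability that the ideal state passes -/

theorem trace_tensorProd {ι D : Type} [Fintype ι] [DecidableEq ι] [Fintype D]
    (M : ι → Matrix D D ℂ) : (tensorProd M).trace = ∏ j, (M j).trace := by
  simp only [Matrix.trace, Matrix.diag_apply, tensorProd]
  rw [Finset.prod_univ_sum, Fintype.piFinset_univ]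

theorem passProb_copies {D : Type} [Fintype D] [DecidableEq D] (N : ℕ) (Ω : Matrix D D ℂ)
    {ψ : D → ℂ} (hψ : star ψ ⬝ᵥ ψ = 1) {w : ℝ} (hw : star ψ ⬝ᵥ Ω.mulVec ψ = w) :
    passProb N Ω (copies N ψ) = w ^ N := by
  have ht : (ketBra ψ).trace = 1 := by
    rw [ketBra, Matrix.trace_vecMulVec, dotProduct_comm, hψ]
  have hΩ : (Ω * ketBra ψ).trace = w := by
    rw [ketBra, Matrix.mul_vecMulVec, Matrix.trace_vecMulVec, dotProduct_comm, hw]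
  have h : ∀ i : Fin (N + 1), (passEffect N Ω i * copies N ψ).trace.re = w ^ N := by
    intro i
    rw [passEffect_eq_tensorProd, copies, ketBra_prod (fun _ => ψ), tensorProd_mul,
      trace_tensorProd, Fin.prod_univ_succAbove _ i]
    simp only [Fin.succAbove_ne, if_true, if_false, ht, hΩ, one_mul,
      Finset.prod_const, Finset.card_univ, Fintype.card_fin, ← Complex.ofReal_pow,
      Complex.ofReal_re]
  have hN : (N : ℝ) + 1 ≠ 0 := by positivity
  simp only [passProb, h, Finset.sum_const, Finset.card_univ, Fintype.card_fin, nsmul_eq_mul]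
  push_cast
  field_simp

/-- Within a sum over all the bit strings, the summand may be replaced by its mean over bit `k`. -/
theorem sum_update_eq (k : Fin n) (f : Bits n → ℂ) :
    ∑ x, f x = ∑ x, (∑ b, f (Function.update x k b)) / 2 := by
  have h : ∀ x : Bits n, ∑ b, f (Function.update x k b) =
      f x + f (Function.update x k (x k + 1)) := by
    intro x
    have : ∀ p : Fin 2, ∑ b, f (Function.update x k b) =
        f (Function.update x k p) + f (Function.update x k (p + 1)) := by
      intro p
      fin_cases p
      · simp [Fin.sum_univ_two]
      · simp [Fin.sum_univ_two, add_comm]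
    rw [this (x k), Function.update_eq_self]
  -- Adding `1` in `Fin 2` flips the bit, so this map permutes the strings.
  have inv : Function.Involutive fun x : Bits n => Function.update x k (x k + 1) := by
    intro x
    have : x k + 1 + 1 = x k := by
      generalize x k = p
      fin_cases p <;> rfl
    simp [this]
  simp only [h, ← Finset.sum_div, Finset.sum_add_distrib]
  have e : ∑ x : Bits n, f (Function.update x k (x k + 1)) = ∑ x, f x :=
    Equiv.sum_comp (inv.toPerm _) f
  rw [e]
  ring

/-- The amplitude by which a factor with rounding error `δ` multiplies the graph state, on the
strings with bit `p`. -/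
def amplitudeFactor (h : ℕ) (δ : ℝ) (p : Fin 2) : ℂ :=
  (1 / (h : ℂ)) * ∑ b, ketBra (ket δ) p b + ((h : ℂ) - 1) / h

theorem sum_amplitudeFactor {h : ℕ} (hh : 0 < h) (δ : ℝ) :
    (∑ p, amplitudeFactor h δ p) / 2 = ((1 - 1 / (h : ℝ) * Real.sin (δ / 2) ^ 2 : ℝ) : ℂ) := by
  have hh' : (h : ℂ) ≠ 0 := Nat.cast_ne_zero.mpr hh.ne'
  have h1 : Real.sin (δ / 2) ^ 2 = (1 - Real.cos δ) / 2 := by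
    rw [Real.sin_sq_eq_half_sub]
    ring_nf
  have h2 : Complex.exp (Complex.I * δ) + Complex.exp (-(Complex.I * δ)) = 2 * Complex.cos δ := by
    rw [Complex.two_cos, mul_comm Complex.I, neg_mul]
  rw [h1]
  simp [amplitudeFactor, Fin.sum_univ_two, ketBra_ket_apply]
  field_simp
  linear_combination h2

namespace WeightedGraph

variable (G : WeightedGraph n)

theorem state_dotProduct_self : star G.state ⬝ᵥ G.state = 1 := by
  have hU : G.prepᴴ * G.prep = 1 := mul_eq_one_comm.mp G.prep_mul_conjTranspose
  have h1 : ∀ x y : Bits n → ℂ, star x ⬝ᵥ y = (vecMulVec y (star x)).trace := fun x y => by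
    rw [Matrix.trace_vecMulVec, dotProduct_comm]
  have h2 : (ketBra G.state).trace = 1 := by
    rw [state_eq, ketBra_mulVec, Matrix.trace_mul_comm, ← Matrix.mul_assoc, hU, Matrix.one_mul,
      show plusState n = fun x => ∏ j, ket 0 (x j) from rfl, ketBra_prod (fun _ => ket 0),
      trace_tensorProd]
    refine Finset.prod_eq_one fun j _ => ?_
    rw [ketBra, Matrix.trace_vecMulVec, dotProduct_comm, star_ket_dotProduct_ket]
  rwa [h1]

theorem state_update {A : Finset (Fin n)} (hA : ∀ j ∈ A, ∀ k ∈ A, ¬ G.graph.Adj j k)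
    {k : Fin n} (hk : k ∈ A) (x : Bits n) (b : Fin 2) :
    G.state (Function.update x k b) = G.state x *
      Complex.exp (Complex.I *
        ((G.bitsPhase A k x * (((b : ℕ) : ℝ) - ((x k : ℕ) : ℝ)) : ℝ) : ℂ)) := by
  have h1 : ∀ p : Fin 2, ket 0 p = 1 / (Real.sqrt 2 : ℂ) := by
    intro p; fin_cases p <;> simp [ket]
  have h2 := G.amplitudePhase_sub hA hk (x := Function.update x k b) (y := x)
    (fun j hj => by simp [hj])
  rw [bitsPhase_update _ hk, Function.update_self] at h2
  rw [← h2]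
  simp only [state_eq, prep, Matrix.mulVec_diagonal, plusState, h1]
  rw [mul_right_comm, ← Complex.exp_add]
  congr 2
  push_cast
  ring

/-- The rounding error of the phase. -/
def phaseError (h : ℕ) (A : Finset (Fin n)) (k : Fin n) (x : Bits n) : ℝ :=
  roundPhase h (G.bitsPhase A k x) - G.bitsPhase A k x

theorem phaseError_update (h : ℕ) {A : Finset (Fin n)} {k k' : Fin n} (hk : k ∈ A) (x : Bits n)
    (b : Fin 2) : G.phaseError h A k' (Function.update x k b) = G.phaseError h A k' x := by
  rw [phaseError, phaseError, G.bitsPhase_update hk]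

/-- Flipping bit `k` changes the amplitude of `|G⟩` by the exact phase, which shifts the rounded
angle to the rounding error. The function `F` carries the effect of factors already applied; these
do not see bit `k`. -/
theorem factor_mulVec {h : ℕ} {A : Finset (Fin n)}
    (hA : ∀ j ∈ A, ∀ k ∈ A, ¬ G.graph.Adj j k) {k : Fin n} (hk : k ∈ A) {F : Bits n → ℂ}
    (hF : ∀ x b, F (Function.update x k b) = F x) :
    (G.factor h A k).mulVec (fun x => G.state x * F x) =
      fun x => G.state x * (amplitudeFactor h (G.phaseError h A k x) (x k) * F x) := by
  funext x
  rw [factor, G.Q_eq_ctrl h hk, Matrix.add_mulVec, Matrix.smul_mulVec, Matrix.smul_mulVec,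
    Matrix.one_mulVec]
  simp only [Pi.add_apply, Pi.smul_apply, smul_eq_mul, ctrl_mulVec, hF, G.state_update hA hk]
  have : ∀ b : Fin 2, ketBra (ket (roundPhase h (G.bitsPhase A k x))) (x k) b * (G.state x *
      Complex.exp (Complex.I *
        ((G.bitsPhase A k x * (((b : ℕ) : ℝ) - ((x k : ℕ) : ℝ)) : ℝ) : ℂ)) * F x) =
      G.state x * F x * ketBra (ket (G.phaseError h A k x)) (x k) b := by
    intro b
    rw [ketBra_ket_apply, ketBra_ket_apply, div_mul_eq_mul_div, mul_div_assoc']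
    congr 1
    rw [mul_right_comm (G.state x), mul_left_comm, ← Complex.exp_add]
    congr 2
    rw [phaseError]
    push_cast
    ring
  simp only [this, ← Finset.mul_sum, amplitudeFactor]
  ring

theorem noncommProd_factor_mulVec {h : ℕ} {A : Finset (Fin n)}
    (hA : ∀ j ∈ A, ∀ k ∈ A, ¬ G.graph.Adj j k) (s : Finset (Fin n)) (hs : s ⊆ A)
    (comm : (s : Set (Fin n)).Pairwise (Function.onFun Commute (G.factor h A))) :
    (s.noncommProd (G.factor h A) comm).mulVec G.state =
      fun x => G.state x * ∏ k ∈ s, amplitudeFactor h (G.phaseError h A k x) (x k) := by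
  induction s using Finset.induction_on with
  | empty => simp
  | insert a s ha ih =>
    have haA : a ∈ A := hs (Finset.mem_insert_self _ _)
    rw [Finset.noncommProd_insert_of_notMem _ _ _ _ ha, ← Matrix.mulVec_mulVec,
      ih ((Finset.subset_insert _ _).trans hs), G.factor_mulVec hA haA]
    · simp only [Finset.prod_insert ha]
    · intro x b
      refine Finset.prod_congr rfl fun k hk => ?_
      rw [G.phaseError_update h haA, Function.update_of_ne (ne_of_mem_of_not_mem hk ha)]

/-- For `k ∈ A` the rounding errors do not depend on bit `k`, so averaging over that bit affects a
single factor, with mean given by `sum_amplitudeFactor`. The weight `r` is general so that the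
induction can absorb the factors already averaged. -/
theorem sum_prod_amplitudeFactor {h : ℕ} (hh : 0 < h) {A : Finset (Fin n)} (s : Finset (Fin n))
    (hs : s ⊆ A) (r : Bits n → ℂ) (hr : ∀ k ∈ s, ∀ x b, r (Function.update x k b) = r x) :
    ∑ x, r x * ∏ k ∈ s, amplitudeFactor h (G.phaseError h A k x) (x k) =
      ∑ x, r x * ∏ k ∈ s,
        ((1 - 1 / (h : ℝ) * Real.sin (G.phaseError h A k x / 2) ^ 2 : ℝ) : ℂ) := by
  induction s using Finset.induction_on generalizing r with
  | empty => simp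
  | insert a s ha ih =>
    have haA : a ∈ A := hs (Finset.mem_insert_self _ _)
    have hsA : s ⊆ A := (Finset.subset_insert _ _).trans hs
    rw [sum_update_eq a]
    have e : ∀ x, (∑ b, r (Function.update x a b) * ∏ k ∈ insert a s,
        amplitudeFactor h (G.phaseError h A k (Function.update x a b))
          (Function.update x a b k)) / 2 =
        (r x * ((1 - 1 / (h : ℝ) * Real.sin (G.phaseError h A a x / 2) ^ 2 : ℝ) : ℂ)) *
          ∏ k ∈ s, amplitudeFactor h (G.phaseError h A k x) (x k) := by
      intro x
      rw [← sum_amplitudeFactor hh]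
      have : ∀ b : Fin 2, ∏ k ∈ s, amplitudeFactor h (G.phaseError h A k x)
          (Function.update x a b k) = ∏ k ∈ s, amplitudeFactor h (G.phaseError h A k x) (x k) :=
        fun b => Finset.prod_congr rfl fun k hk => by
          rw [Function.update_of_ne (ne_of_mem_of_not_mem hk ha)]
      simp only [G.phaseError_update h haA, hr a (Finset.mem_insert_self _ _),
        Finset.prod_insert ha, Function.update_self, this]
      rw [← Finset.mul_sum, ← Finset.sum_mul]
      ring
    simp only [e]
    rw [ih hsA]
    · refine Finset.sum_congr rfl fun x _ => ?_
      rw [Finset.prod_insert ha, mul_assoc]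
    · intro k hk x b
      rw [hr k (Finset.mem_insert_of_mem hk), G.phaseError_update h (hsA hk)]

theorem normSq_state (x : Bits n) : star (G.state x) * G.state x = 1 / 2 ^ n := by
  have h1 : ∀ p : Fin 2, ket 0 p = 1 / (Real.sqrt 2 : ℂ) := by
    intro p; fin_cases p <;> simp [ket]
  have h2 : (Real.sqrt 2 : ℂ) * (Real.sqrt 2 : ℂ) = 2 := by
    rw [← Complex.ofReal_mul, Real.mul_self_sqrt (by norm_num)]; norm_num
  have h3 : (starRingEnd ℂ) (Complex.exp (Complex.I * (G.amplitudePhase x : ℂ))) *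
      Complex.exp (Complex.I * (G.amplitudePhase x : ℂ)) = 1 := by
    rw [← Complex.exp_conj, ← Complex.exp_add]; simp
  have h4 : ((1 / (Real.sqrt 2 : ℂ)) ^ n) * ((1 / (Real.sqrt 2 : ℂ)) ^ n) = 1 / 2 ^ n := by
    rw [← mul_pow, div_mul_div_comm, h2]; simp
  simp only [state_eq, prep, Matrix.mulVec_diagonal, plusState, h1, Finset.prod_const,
    Finset.card_univ, Fintype.card_fin, RCLike.star_def, map_mul, map_pow, map_div₀, map_one,
    Complex.conj_ofReal]
  linear_combination h3 * ((1 / (Real.sqrt 2 : ℂ)) ^ n) * ((1 / (Real.sqrt 2 : ℂ)) ^ n) + h4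

theorem state_Pbar_state {h : ℕ} (hh : 0 < h) {A : Finset (Fin n)}
    (hA : ∀ j ∈ A, ∀ k ∈ A, ¬ G.graph.Adj j k) :
    ∃ w : ℝ, star G.state ⬝ᵥ (G.Pbar h A).mulVec G.state = w ∧
      (1 - 1 / (h : ℝ) * Real.sin (Real.pi / (4 * h)) ^ 2) ^ A.card ≤ w := by
  refine ⟨∑ x : Bits n, 1 / 2 ^ n *
    ∏ k ∈ A, (1 - 1 / (h : ℝ) * Real.sin (G.phaseError h A k x / 2) ^ 2), ?_, ?_⟩
  · have := G.sum_prod_amplitudeFactor hh A subset_rfl (fun _ => 1 / 2 ^ n) (fun _ _ _ _ => rfl)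
    rw [Pbar, G.noncommProd_factor_mulVec hA A subset_rfl]
    simp only [dotProduct, Pi.star_apply, ← mul_assoc, normSq_state]
    rw [this]
    push_cast
    rfl
  · have hh' : (1 : ℝ) ≤ h := Nat.one_le_cast.mpr hh
    have hpos : (0 : ℝ) < 1 / h := by positivity
    set c := 1 - 1 / (h : ℝ) * Real.sin (Real.pi / (4 * h)) ^ 2 with hc
    -- Nonnegativity of the base, needed to compare products factor by factor, follows from `1 / h ≤
    -- 1` and `sin² ≤ 1`.
    have hc0 : 0 ≤ c := by
      have h1 : 1 / (h : ℝ) ≤ 1 := by rw [div_le_one (by linarith)]; exact hh'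
      nlinarith [Real.sin_sq_le_one (Real.pi / (4 * h)), sq_nonneg (Real.sin (Real.pi / (4 * h)))]
    have hle : ∀ x : Bits n, c ^ A.card ≤
        ∏ k ∈ A, (1 - 1 / (h : ℝ) * Real.sin (G.phaseError h A k x / 2) ^ 2) := by
      intro x
      rw [← Finset.prod_const]
      refine Finset.prod_le_prod (fun _ _ => hc0) fun k _ => ?_
      have h1 := abs_sin_half_le hh (abs_roundPhase_sub_le hh (G.bitsPhase A k x))
      have h2 := pow_le_pow_left₀ (abs_nonneg _) h1 2
      rw [sq_abs] at h2
      exact sub_le_sub_left (mul_le_mul_of_nonneg_left h2 hpos.le) _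
    have h2 : (2 : ℝ) ^ n ≠ 0 := by positivity
    calc c ^ A.card = ∑ x : Bits n, 1 / 2 ^ n * c ^ A.card := by
          simp [Finset.card_univ, h2]
      _ ≤ _ := Finset.sum_le_sum fun x _ =>
          mul_le_mul_of_nonneg_left (hle x) (by positivity)

end WeightedGraph

theorem le_passProb_state {m : ℕ} {G : WeightedGraph n} (𝒜 : IndependenceCover G m)
    (hm : 0 < m) {h : ℕ} (hh : 0 < h) (N : ℕ) :
    (1 - 1 / (h : ℝ) * Real.sin (Real.pi / (4 * h)) ^ 2) ^ (N * 𝒜.maxCard) ≤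
      passProb N (omegaBar 𝒜 h) (copies N G.state) := by
  choose w hw hwle using fun l => G.state_Pbar_state hh (𝒜.indep l)
  have hh' : (1 : ℝ) ≤ h := Nat.one_le_cast.mpr hh
  have hm' : (m : ℝ) ≠ 0 := Nat.cast_ne_zero.mpr hm.ne'
  set c := 1 - 1 / (h : ℝ) * Real.sin (Real.pi / (4 * h)) ^ 2 with hc
  have h1 : 1 / (h : ℝ) ≤ 1 := by rw [div_le_one (by linarith)]; exact hh'
  have hpos : (0 : ℝ) < 1 / h := by positivity
  have hc0 : 0 ≤ c := by
    nlinarith [Real.sin_sq_le_one (Real.pi / (4 * h)), sq_nonneg (Real.sin (Real.pi / (4 * h)))]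
  have hc1 : c ≤ 1 := by
    nlinarith [mul_nonneg hpos.le (sq_nonneg (Real.sin (Real.pi / (4 * h))))]
  have hΩ : star G.state ⬝ᵥ (omegaBar 𝒜 h).mulVec G.state = ((∑ l, 1 / (m : ℝ) * w l : ℝ) : ℂ) := by
    rw [omegaBar, Matrix.sum_mulVec, dotProduct_sum]
    simp only [Matrix.smul_mulVec, dotProduct_smul, hw, smul_eq_mul]
    push_cast
    rfl
  rw [passProb_copies N _ G.state_dotProduct_self hΩ, mul_comm N, pow_mul]
  refine pow_le_pow_left₀ (pow_nonneg hc0 _) ?_ N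
  -- Since `0 ≤ c ≤ 1`, the largest set gives the smallest power, which bounds every term of the
  -- mean over `l`.
  calc c ^ 𝒜.maxCard = ∑ _l : Fin m, 1 / (m : ℝ) * c ^ 𝒜.maxCard := by
        simp [hm']
    _ ≤ _ := Finset.sum_le_sum fun l _ => mul_le_mul_of_nonneg_left
        ((pow_le_pow_of_le_one hc0 hc1
          (Finset.le_sup (f := fun l => (𝒜.A l).card) (Finset.mem_univ l))).trans (hwle l))
        (by positivity)

end WGS

end

theorem theorem4 {n m : ℕ} (G : WGS.WeightedGraph n) (𝒜 : WGS.IndependenceCover G m)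
    (hm : 0 < m) (hdisj : ∀ l l', l ≠ l' → Disjoint (𝒜.A l) (𝒜.A l'))
    (h : ℕ) (hh : 0 < h) (N : ℕ) (hN : 0 < N) (β : ℝ) (hβ : 1 / ((N : ℝ) + 1) ≤ β) :
    (1 - 1 / (h : ℝ) * Real.sin (Real.pi / (4 * h)) ^ 2) ^ (N * 𝒜.maxCard) ≤
        WGS.passProb N (WGS.omegaBar 𝒜 h) (WGS.copies N G.state) ∧
      ∀ ρ : Matrix (Fin (N + 1) → WGS.Bits n) (Fin (N + 1) → WGS.Bits n) ℂ,
        WGS.IsDensity ρ →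
        β ≤ WGS.passProb N (WGS.omegaBar 𝒜 h) ρ →
        1 - ((m : ℝ) * h * (1 - β) / (β * N) + n * Real.sin (Real.pi / (4 * h))) ≤
          WGS.fidelity G.state
            (WGS.resultantState N (WGS.omegaBar 𝒜 h) ρ) := by
  refine ⟨WGS.le_passProb_state 𝒜 hm hh N, fun ρ hρ hpass => ?_⟩
  have hβ0 : 0 < β := lt_of_lt_of_le (by positivity) hβ
  exact WGS.le_fidelity_resultantState hN (WGS.omegaBar_posSemidef 𝒜 hh)
    (WGS.one_sub_omegaBar_posSemidef 𝒜 hm hh) G.state (by positivity)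
    (WGS.infidelity_le 𝒜 hm hdisj hh) hρ hβ0 hpass
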